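/- Let $I\subset\mathbb R$ be a nonempty bounded open interval. For $k\in\mathbb N$, $C^k(\overline I)$ denotes the space of complex-valued $C^k$ functions on $I$ all of whose derivatives of order $\le k$ extend continuously to $\overline I$, with norm $\|f\|_{C^k(\overline I)}=\sup_{j\le k,\,t\in I}|f^{(j)}(t)|$. For $1\le p<\infty$, $L^p_w(I)$ denotes the weak Lebesgue space of measurable $f:I\to\mathbb C$ with $\|f\|_{p,w,I}=\sup_{r\ge 0} r\,|\{t\in I: |f(t)|>r\}|^{1/p}<\infty$. Derivatives $\lambda'$ are taken in the sense of distributions on $I$. (1) Let $P(t)(Z)=Z^3+a_1(t)Z^2+a_2(t)Z+a_3(t)$, $t\in I$, with $a_1,a_2,a_3\in C^6(\overline I)$, and let $\lambda:I\to\mathbb C$ be continuous with $P(t)(\lambda(t))=0$ for all $t\in I$. Then $\lambda'$ is a function in $L^{6/5}_w(I)$, and $\lambda\in W^{1,q}(I)$ for every $q\in[1,6/5)$. (2) Let $P_\nu(t)(Z)=Z^3+a_{\nu,1}(t)Z^2+a_{\nu,2}(t)Z+a_{\nu,3}(t)$, $\nu\in\mathcal N$, be a family of such curves of polynomials, indexed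 by an arbitrary set $\mathcal N$, whose set of coefficients $\{a_{\nu,j}:\nu\in\mathcal N,\ j=1,2,3\}$ is bounded in $C^6(\overline I)$. Then the set $\{\lambda_\nu' : \nu\in\mathcal N,\ \lambda_\nu\in C^0(I),\ P_\nu(\lambda_\nu)=0\text{ on }I\}$ is bounded in $L^{6/5}_w(I)$; that is, there is a constant $C$ such that $\|\lambda_\nu'\|_{6/5,w,I}\le C$ for all $\nu\in\mathcal N$ and all continuous roots $\lambda_\nu$ of $P_\nu$ on $I$. -/

import Mathlib

open MeasureTheory Set
open scoped NNReal ENNReal ContDiff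

noncomputable section

/-- `f ∈ C^k(closure Ω)` for an open set `Ω ⊆ ℝ`: `f` is of class `C^k` on `Ω` and each derivative
of order `≤ k` has a continuous extension to the closure of `Ω`. -/
structure MemCkClosure (k : ℕ) (f : ℝ → ℂ) (Ω : Set ℝ) : Prop where
  contDiffOn : ContDiffOn ℝ k f Ω
  exists_extension : ∀ j ≤ k, ∃ g : ℝ → ℂ,
    ContinuousOn g (closure Ω) ∧ EqOn g (iteratedDerivWithin j f Ω) Ω

/-- The norm of `C^k(closure Ω)`: the supremum over `j ≤ k` and `x ∈ Ω` of `|f^{(j)}(x)|`. -/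
def ckClosureNorm (k : ℕ) (f : ℝ → ℂ) (Ω : Set ℝ) : ℝ≥0∞ :=
  ⨆ j ≤ k, ⨆ x ∈ Ω, ‖iteratedDerivWithin j f Ω x‖ₑ

/-- The weak Lebesgue quasi-norm `sup_{r ≥ 0} r * |{x ∈ Ω : |f x| > r}|^{1/p}`. -/
def weakLpQuasinorm (p : ℝ) (f : ℝ → ℂ) (Ω : Set ℝ) : ℝ≥0∞ :=
  ⨆ r : ℝ≥0, (r : ℝ≥0∞) * volume {x ∈ Ω | (r : ℝ) < ‖f x‖} ^ (1 / p)

/-- `f` belongs to the weak Lebesgue space `L_w^p(Ω)`. -/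
structure MemWeakLp (p : ℝ) (f : ℝ → ℂ) (Ω : Set ℝ) : Prop where
  aestronglyMeasurable : AEStronglyMeasurable f (volume.restrict Ω)
  quasinorm_lt_top : weakLpQuasinorm p f Ω < ⊤

/-- On the open set `Ω ⊆ ℝ` the distributional derivative of the locally integrable function `f`
is (represented by) the locally integrable function `g`. -/
structure HasWeakDerivOn (f g : ℝ → ℂ) (Ω : Set ℝ) : Prop where
  locallyIntegrableOn : LocallyIntegrableOn f Ω
  locallyIntegrableOn_deriv : LocallyIntegrableOn g Ω
  integral_eq : ∀ φ : ℝ → ℂ, ContDiff ℝ ∞ φ → HasCompactSupport φ → tsupport φ ⊆ Ω →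
    ∫ x in Ω, f x * deriv φ x = -∫ x in Ω, g x * φ x

/-- `f` belongs to the Sobolev space `W^{1,q}(Ω)`, for an open set `Ω ⊆ ℝ` and `1 ≤ q < ∞`. -/
def MemW1 (q : ℝ) (f : ℝ → ℂ) (Ω : Set ℝ) : Prop :=
  MemLp f (ENNReal.ofReal q) (volume.restrict Ω) ∧
    ∃ g : ℝ → ℂ, HasWeakDerivOn f g Ω ∧ MemLp g (ENNReal.ofReal q) (volume.restrict Ω)

/-- The curve of monic cubic polynomials `P(t)(Z) = Z^3 + a₁(t) Z^2 + a₂(t) Z + a₃(t)`, where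
`a₁, a₂, a₃` are `a 0, a 1, a 2`. -/
def cubicCurve (a : Fin 3 → ℝ → ℂ) (t : ℝ) : Polynomial ℂ :=
  Polynomial.X ^ 3 + Polynomial.C (a 0 t) * Polynomial.X ^ 2
    + Polynomial.C (a 1 t) * Polynomial.X + Polynomial.C (a 2 t)

/-- `lam` is a continuous root of the curve of polynomials `P` on `Ω`. -/
structure IsContinuousRootOn (lam : ℝ → ℂ) (P : ℝ → Polynomial ℂ) (Ω : Set ℝ) : Prop where
  continuousOn : ContinuousOn lam Ω
  isRoot : ∀ t ∈ Ω, (P t).IsRoot (lam t)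

end

/-! Adding a third of the leading coefficient `a 0` to the root turns the equation into x³ + px + q
= 0. Put w = 3x² + p and D = 4p³ + 27q² (minus the discriminant). Where w ≠ 0 the root is
differentiable, and weighing x, p, q, D with degrees 1, 2, 3, 6 bounds |x'| by a constant times H =
|p'|/|p|^(1/2) + |q'|/|q|^(2/3) + |D'|/|D|^(5/6) (`enorm_deriv_root_le`). Where w = 0 one has p =
-3x² and q = 2x³, so p and q alone control the increments of x between such points. Gluing the two
cases (`enorm_root_sub_le`) bounds every increment of x by an integral of H, with no
differentiability needed at multiple roots.

It remains to place |f'|/|f|^(1-1/k) in weak L^(k/(k-1)), uniformly in terms of bounds on the first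
k derivatives of f (`exists_weakBound_rootDeriv`). This goes by induction on k. With k = n + 1 and u
= f', a superlevel set of the quotient is {|f| < ε|u|^((n+1)/n)}, where ε is a negative power of the
level. On it an arctan expression in f and u, bounded by a multiple of ε, grows at rate at least 1/4
up to an error ε|u'|/|u|^(1-1/n). That error is the quotient of order n for u, whose integral the
induction bounds; hence the set has measure O(ε) (`volume_abs_lt_mul_rpow_le`). The weak exponent
exceeds 1, so integrability passes to the next order. The orders 2, 3, 6 give exponents 2, 3/2, 6/5:
the sixth root of D dictates both the exponent 6/5 and the six derivatives.

A function whose increments are bounded by integrals of an integrable H is locally absolutely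
continuous with |x'| ≤ H almost everywhere, and its pointwise derivative is its weak derivative. All
constants depend only on the interval and on the bound for the coefficients. -/

/-! ### Quotients f'/f^(1-1/k) and the pointwise bound at a simple root. -/

/-- If `g` is the derivative of `f`, this is (up to the factor `k`) the absolute value of the
derivative of a `k`-th root of `f`. -/
noncomputable def rootDeriv {E : Type*} [NormedAddCommGroup E] (k : ℕ) (f g : ℝ → E) (t : ℝ) :
    ℝ≥0∞ :=
  ‖g t‖ₑ / ‖f t‖ₑ ^ (1 - 1 / (k : ℝ))

/-- The denominator is at most T^k. Taking T comparable to the size of the root makes the later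
estimates homogeneous in T. -/
theorem ofReal_div_pow_le_rootDeriv {E : Type*} [NormedAddCommGroup E] {k : ℕ} {f g : ℝ → E}
    {t T : ℝ} (hT : 0 < T) (hf : ‖f t‖ ≤ T ^ (k + 1)) :
    ENNReal.ofReal (‖g t‖ / T ^ k) ≤ rootDeriv (k + 1) f g t := by
  unfold rootDeriv
  have he : (1 : ℝ) - 1 / ((k + 1 : ℕ) : ℝ) = k / (k + 1) := by
    push_cast; field_simp; ring
  rw [he, ENNReal.ofReal_div_of_pos (by positivity), ofReal_norm]
  gcongr
  calc ‖f t‖ₑ ^ ((k : ℝ) / (k + 1)) ≤ (ENNReal.ofReal (T ^ (k + 1))) ^ ((k : ℝ) / (k + 1)) := by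
        gcongr
        rw [← ofReal_norm]
        exact ENNReal.ofReal_le_ofReal hf
    _ = ENNReal.ofReal (T ^ k) := by
        rw [ENNReal.ofReal_rpow_of_nonneg (by positivity) (by positivity)]
        congr 1
        rw [← Real.rpow_natCast, ← Real.rpow_mul hT.le, ← Real.rpow_natCast]
        congr 1
        push_cast
        field_simp

/-- The derivative of a simple root of a depressed cubic is controlled by the derivatives of
radicals of the coefficients and of the discriminant. -/
theorem enorm_deriv_root_le {p q p' q' : ℝ → ℂ} {t : ℝ} {x x' : ℂ}
    (hx : x ^ 3 + p t * x + q t = 0) (hw : 3 * x ^ 2 + p t ≠ 0)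
    (hx' : x' * (3 * x ^ 2 + p t) = -(p' t * x + q' t)) :
    ‖x'‖ₑ ≤ 4 * (rootDeriv 2 p p' t + rootDeriv 3 q q' t +
      rootDeriv 6 (fun s => 4 * p s ^ 3 + 27 * q s ^ 2)
        (fun s => 12 * p s ^ 2 * p' s + 54 * q s * q' s) t) := by
  set w : ℂ := 3 * x ^ 2 + p t with hwdef
  have hp : p t = w - 3 * x ^ 2 := by rw [hwdef]; ring
  have hq : q t = x * (2 * x ^ 2 - w) := by rw [hwdef]; linear_combination hx
  have hw0 : 0 < ‖w‖ := norm_pos_iff.2 hw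
  set A := ‖p' t‖
  set B := ‖q' t‖
  set G := ‖12 * p t ^ 2 * p' t + 54 * q t * q' t‖ with hG
  -- Since p = w - 3x² and q = x(2x² - w), any s dominating |x| and |w|^(1/2) gives |p| ≤ (2s)² and
  -- |q| ≤ (2s)³.
  have key : ∀ s : ℝ, 0 < s → ‖x‖ ≤ s → ‖w‖ ≤ s ^ 2 →
      ENNReal.ofReal (A / (2 * s)) ≤ rootDeriv 2 p p' t ∧
      ENNReal.ofReal (B / (2 * s) ^ 2) ≤ rootDeriv 3 q q' t := by
    intro s hs hxs hws
    have h2 : ‖x‖ ^ 2 ≤ s ^ 2 := by gcongr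
    constructor
    · have := ofReal_div_pow_le_rootDeriv (k := 1) (f := p) (g := p') (t := t) (T := 2 * s)
        (by positivity) ?_
      · simpa using this
      · rw [hp]
        calc ‖w - 3 * x ^ 2‖ ≤ ‖w‖ + ‖3 * x ^ 2‖ := norm_sub_le _ _
          _ = ‖w‖ + 3 * ‖x‖ ^ 2 := by simp
          _ ≤ (2 * s) ^ (1 + 1) := by ring_nf; linarith
    · have := ofReal_div_pow_le_rootDeriv (k := 2) (f := q) (g := q') (t := t) (T := 2 * s)
        (by positivity) ?_
      · simpa using this
      · rw [hq]
        calc ‖x * (2 * x ^ 2 - w)‖ ≤ ‖x‖ * (‖2 * x ^ 2‖ + ‖w‖) := by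
              rw [norm_mul]; gcongr; exact norm_sub_le _ _
          _ = ‖x‖ * (2 * ‖x‖ ^ 2 + ‖w‖) := by simp
          _ ≤ s * (2 * s ^ 2 + s ^ 2) := by gcongr
          _ ≤ (2 * s) ^ (2 + 1) := by ring_nf; nlinarith [pow_pos hs 3]
  -- If w dominates, dividing x'w = -(p'x + q') by w suffices. If x² dominates, w may be small, and
  -- D must compensate.
  rcases le_total (‖x‖ ^ 2) ‖w‖ with h | h
  · set s := √‖w‖ with hs
    have hs0 : 0 < s := Real.sqrt_pos.2 hw0
    have hs2 : s ^ 2 = ‖w‖ := Real.sq_sqrt hw0.le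
    have hxs : ‖x‖ ≤ s := Real.le_sqrt_of_sq_le h
    obtain ⟨h1, h2⟩ := key s hs0 hxs hs2.ge
    have hb : ‖x'‖ ≤ 4 * (A / (2 * s) + B / (2 * s) ^ 2) := by
      have e : ‖x'‖ * s ^ 2 ≤ A * s + B := by
        rw [hs2, ← norm_mul, hx', norm_neg]
        calc _ ≤ ‖p' t * x‖ + ‖q' t‖ := norm_add_le _ _
          _ ≤ _ := by rw [norm_mul]; gcongr
      have : 4 * (A / (2 * s) + B / (2 * s) ^ 2) = (2 * A * s + B) / s ^ 2 := by
        field_simp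
        ring
      rw [this, le_div_iff₀ (by positivity)]
      have : 0 ≤ A * s := by positivity
      linarith
    calc ‖x'‖ₑ = ENNReal.ofReal ‖x'‖ := (ofReal_norm _).symm
      _ ≤ ENNReal.ofReal (4 * (A / (2 * s) + B / (2 * s) ^ 2)) := ENNReal.ofReal_le_ofReal hb
      _ = 4 * (ENNReal.ofReal (A / (2 * s)) + ENNReal.ofReal (B / (2 * s) ^ 2)) := by
          rw [ENNReal.ofReal_mul (by norm_num), ENNReal.ofReal_add (by positivity) (by positivity)]
          norm_num
      _ ≤ _ := by
          exact mul_le_mul_right ((add_le_add h1 h2).trans le_self_add) _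
  · set s := ‖x‖ with hs
    have hs0 : 0 < s := by
      by_contra! h0
      have : s = 0 := le_antisymm h0 (norm_nonneg _)
      rw [this] at h
      norm_num at h
      exact hw h
    have hx0 : x ≠ 0 := norm_pos_iff.1 hs0
    obtain ⟨h1, h2⟩ := key s hs0 le_rfl h
    -- D = w²(4w - 9x²) is O((|w|s)²), so u is the scale of its sixth root.
    set u : ℝ := (‖w‖ * s) ^ (1 / 3 : ℝ) with hu
    have hu0 : 0 < u := by positivity
    have hu3 : u ^ 3 = ‖w‖ * s := by
      rw [hu, ← Real.rpow_natCast, ← Real.rpow_mul (by positivity)]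
      norm_num
    have hus : u ≤ s := by
      have : u ^ 3 ≤ s ^ 3 := by rw [hu3]; nlinarith
      exact le_of_pow_le_pow_left₀ (by norm_num) hs0.le this
    have h3 : ENNReal.ofReal (G / (2 * u) ^ 5) ≤
        rootDeriv 6 (fun s => 4 * p s ^ 3 + 27 * q s ^ 2)
        (fun s => 12 * p s ^ 2 * p' s + 54 * q s * q' s) t := by
      have hD0 := ofReal_div_pow_le_rootDeriv (k := 5) (T := 2 * u) (t := t)
        (f := fun s => 4 * p s ^ 3 + 27 * q s ^ 2)
        (g := fun s => 12 * p s ^ 2 * p' s + 54 * q s * q' s) (by positivity)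
      refine hD0 ?_
      clear hD0
      have : 4 * p t ^ 3 + 27 * q t ^ 2 = w ^ 2 * (4 * w - 9 * x ^ 2) := by rw [hp, hq]; ring
      rw [this]
      calc ‖w ^ 2 * (4 * w - 9 * x ^ 2)‖ ≤ ‖w‖ ^ 2 * (‖4 * w‖ + ‖9 * x ^ 2‖) := by
            rw [norm_mul, norm_pow]; gcongr; exact norm_sub_le _ _
        _ = ‖w‖ ^ 2 * (4 * ‖w‖ + 9 * s ^ 2) := by simp [hs]
        _ ≤ ‖w‖ ^ 2 * (4 * s ^ 2 + 9 * s ^ 2) := by gcongr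
        _ ≤ 64 * (‖w‖ * s) ^ 2 := by nlinarith [sq_nonneg (‖w‖ * s)]
        _ = (2 * u) ^ (5 + 1) := by rw [← hu3]; ring
    have hb : ‖x'‖ ≤ 4 * (A / (2 * s) + B / (2 * s) ^ 2 + G / (2 * u) ^ 5) := by
      -- The combination isolates D'; the p' and q' terms left over carry a factor w, which cancels
      -- against the w on the left.
      have e : 108 * x ^ 3 * w * x' = -(12 * p t ^ 2 * p' t + 54 * q t * q' t)
          + w * (12 * w - 72 * x ^ 2) * p' t - 54 * w * x * q' t := by
        have : 108 * x ^ 3 * w * x' = 108 * x ^ 3 * (x' * w) := by ring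
        rw [this, hx', hp, hq]; ring
      have e2 : 108 * s ^ 3 * ‖w‖ * ‖x'‖ ≤ G + ‖w‖ * (84 * s ^ 2) * A + 54 * ‖w‖ * s * B := by
        have : 108 * s ^ 3 * ‖w‖ * ‖x'‖ = ‖108 * x ^ 3 * w * x'‖ := by simp [hs]
        rw [this, e]
        refine (norm_sub_le _ _).trans (add_le_add ((norm_add_le _ _).trans (add_le_add ?_ ?_)) ?_)
        · rw [norm_neg]
        · rw [norm_mul, norm_mul]
          gcongr
          calc ‖12 * w - 72 * x ^ 2‖ ≤ ‖12 * w‖ + ‖72 * x ^ 2‖ := norm_sub_le _ _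
            _ = 12 * ‖w‖ + 72 * s ^ 2 := by simp [hs]
            _ ≤ _ := by linarith
        · simp [hs]; rfl
      have hu5 : u ^ 5 ≤ s ^ 3 * ‖w‖ := by
        calc u ^ 5 = u ^ 3 * u ^ 2 := by ring
          _ ≤ u ^ 3 * s ^ 2 := by gcongr
          _ = _ := by rw [hu3]; ring
      have hG1 : G / (s ^ 3 * ‖w‖) ≤ G / u ^ 5 := by gcongr
      have e3 : ‖x'‖ ≤ G / (s ^ 3 * ‖w‖) / 108 + 84 / 108 * (A / s) + 1 / 2 * (B / s ^ 2) := by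
        have : G / (s ^ 3 * ‖w‖) / 108 + 84 / 108 * (A / s) + 1 / 2 * (B / s ^ 2) =
            (G + ‖w‖ * (84 * s ^ 2) * A + 54 * ‖w‖ * s * B) / (108 * s ^ 3 * ‖w‖) := by
          field_simp
          ring
        rw [this, le_div_iff₀ (by positivity)]
        linarith
      have e4 : 4 * (A / (2 * s) + B / (2 * s) ^ 2 + G / (2 * u) ^ 5)
          = 2 * (A / s) + B / s ^ 2 + 1 / 8 * (G / u ^ 5) := by
        field_simp
        ring
      rw [e4]
      have : 0 ≤ A / s := by positivity
      have : 0 ≤ B / s ^ 2 := by positivity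
      have : 0 ≤ G / u ^ 5 := by positivity
      linarith
    calc ‖x'‖ₑ = ENNReal.ofReal ‖x'‖ := (ofReal_norm _).symm
      _ ≤ ENNReal.ofReal (4 * (A / (2 * s) + B / (2 * s) ^ 2 + G / (2 * u) ^ 5)) :=
          ENNReal.ofReal_le_ofReal hb
      _ = 4 * (ENNReal.ofReal (A / (2 * s)) + ENNReal.ofReal (B / (2 * s) ^ 2)
            + ENNReal.ofReal (G / (2 * u) ^ 5)) := by
          rw [ENNReal.ofReal_mul (by norm_num), ENNReal.ofReal_add (by positivity) (by positivity),
            ENNReal.ofReal_add (by positivity) (by positivity)]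
          norm_num
      _ ≤ _ := by gcongr

/-! ### Increments of a continuous root, across multiple roots included. -/

theorem enorm_sub_le_lintegral_of_hasDerivAt {f f' : ℝ → ℂ} {x y : ℝ} (hxy : x ≤ y)
    (hf : ∀ t ∈ Icc x y, HasDerivAt f (f' t) t) (hf' : ContinuousOn f' (Icc x y)) :
    ‖f x - f y‖ₑ ≤ ∫⁻ t in Ioc x y, ‖f' t‖ₑ := by
  have hi : IntervalIntegrable f' volume x y := by
    apply ContinuousOn.intervalIntegrable
    rwa [uIcc_of_le hxy]
  have h := intervalIntegral.integral_eq_sub_of_hasDerivAt (by rwa [uIcc_of_le hxy]) hi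
  rw [← neg_sub, enorm_neg, ← h, intervalIntegral.integral_of_le hxy]
  exact enorm_integral_le_lintegral_enorm _

/-- While |f| ≤ T^(k+1), the quotient dominates |f'|/T^k and integrates to the increment over T^k.
If f leaves this ball, stopping at the first exit already gives an increment of at least T^(k+1)/2,
hence the minimum. -/
theorem ofReal_min_le_lintegral_rootDeriv {k : ℕ} {f f' : ℝ → ℂ} {x y T : ℝ} (hxy : x ≤ y)
    (hf : ∀ t ∈ Icc x y, HasDerivAt f (f' t) t) (hf' : ContinuousOn f' (Icc x y)) (hT : 0 < T)
    (hfx : ‖f x‖ ≤ T ^ (k + 1) / 2) :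
    ENNReal.ofReal (min ‖f x - f y‖ (T ^ (k + 1) / 2) / T ^ k) ≤
      ∫⁻ t in Ioc x y, rootDeriv (k + 1) f f' t := by
  have hfc : ContinuousOn f (Icc x y) := fun t ht => (hf t ht).continuousAt.continuousWithinAt
  have hT' : 0 < T ^ (k + 1) := by positivity
  have main : ∀ r ∈ Icc x y, (∀ t ∈ Ioc x r, ‖f t‖ ≤ T ^ (k + 1)) →
      ENNReal.ofReal (‖f x - f r‖ / T ^ k) ≤ ∫⁻ t in Ioc x y, rootDeriv (k + 1) f f' t := by
    intro r hr hb
    have hsub : Icc x r ⊆ Icc x y := Icc_subset_Icc_right hr.2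
    calc ENNReal.ofReal (‖f x - f r‖ / T ^ k)
        = ‖f x - f r‖ₑ * (ENNReal.ofReal (T ^ k))⁻¹ := by
          rw [ENNReal.ofReal_div_of_pos (by positivity), ofReal_norm, div_eq_mul_inv]
      _ ≤ (∫⁻ t in Ioc x r, ‖f' t‖ₑ) * (ENNReal.ofReal (T ^ k))⁻¹ := by
          gcongr
          exact enorm_sub_le_lintegral_of_hasDerivAt hr.1 (fun t ht => hf t (hsub ht))
            (hf'.mono hsub)
      _ = ∫⁻ t in Ioc x r, ‖f' t‖ₑ * (ENNReal.ofReal (T ^ k))⁻¹ := by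
          rw [lintegral_mul_const']
          simp only [ne_eq, ENNReal.inv_eq_top, ENNReal.ofReal_eq_zero, not_le]
          positivity
      _ ≤ ∫⁻ t in Ioc x r, rootDeriv (k + 1) f f' t := by
          refine setLIntegral_mono' measurableSet_Ioc fun t ht => ?_
          refine le_trans (le_of_eq ?_) (ofReal_div_pow_le_rootDeriv hT (hb t ht))
          rw [ENNReal.ofReal_div_of_pos (by positivity), ofReal_norm, div_eq_mul_inv]
      _ ≤ _ := lintegral_mono_set (Ioc_subset_Ioc_right hr.2)
  by_cases hE : ∀ t ∈ Ioc x y, ‖f t‖ ≤ T ^ (k + 1)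
  · refine le_trans (ENNReal.ofReal_le_ofReal ?_) (main y ⟨hxy, le_rfl⟩ hE)
    gcongr
    exact min_le_left _ _
  · push Not at hE
    obtain ⟨z, hz, hfz⟩ := hE
    have hK : IsCompact (Icc x y ∩ (fun t => ‖f t‖) ⁻¹' {T ^ (k + 1)}) :=
      isCompact_Icc.of_isClosed_subset
        (hfc.norm.preimage_isClosed_of_isClosed isClosed_Icc isClosed_singleton) inter_subset_left
    have hne : (Icc x y ∩ (fun t => ‖f t‖) ⁻¹' {T ^ (k + 1)}).Nonempty := by
      have hiv := intermediate_value_Icc hz.1.le (hfc.norm.mono (Icc_subset_Icc_right hz.2))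
      obtain ⟨c, hc, hce⟩ := hiv ⟨by linarith, hfz.le⟩
      exact ⟨c, ⟨hc.1, hc.2.trans hz.2⟩, hce⟩
    obtain ⟨r, ⟨hr, hre⟩, hmin⟩ := hK.exists_isLeast hne
    have hre' : ‖f r‖ = T ^ (k + 1) := hre
    refine le_trans (ENNReal.ofReal_le_ofReal ?_) (main r hr ?_)
    · gcongr
      refine (min_le_right _ _).trans ?_
      have := norm_sub_norm_le (f r) (f x)
      rw [norm_sub_rev] at this
      linarith
    · intro t ht
      by_contra! hlt
      have hiv := intermediate_value_Icc ht.1.le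
        (hfc.norm.mono (Icc_subset_Icc_right (ht.2.trans hr.2)))
      obtain ⟨c, hc, hce⟩ := hiv ⟨by linarith, hlt.le⟩
      have h1 : r ≤ c := hmin ⟨⟨hc.1, hc.2.trans (ht.2.trans hr.2)⟩, hce⟩
      have h2 : t = r := le_antisymm ht.2 (h1.trans hc.2)
      rw [h2, hre'] at hlt
      exact lt_irrefl _ hlt

theorem lintegral_Ioc_add_le {h : ℝ → ℝ≥0∞} {x y z : ℝ} :
    (∫⁻ t in Ioc x y, h t) + ∫⁻ t in Ioc y z, h t = ∫⁻ t in Ioc x y ∪ Ioc y z, h t := by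
  rw [lintegral_union measurableSet_Ioc]
  exact Set.disjoint_left.2 fun t h1 h2 => (h1.2.trans_lt h2.1).false

/-- If a continuous function varies by at most the integral of `h` between any two points of a
closed set `{w = 0}` and on any compact interval avoiding it, then so it does between any two
points. -/
theorem enorm_sub_le_lintegral_of_glue {f w : ℝ → ℂ} {h : ℝ → ℝ≥0∞} {a b : ℝ}
    (hf : ContinuousOn f (Ioo a b)) (hw : ContinuousOn w (Ioo a b))
    (h0 : ∀ x ∈ Ioo a b, ∀ y ∈ Ioo a b, x ≤ y → w x = 0 → w y = 0 →
      ‖f x - f y‖ₑ ≤ ∫⁻ t in Ioc x y, h t)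
    (h1 : ∀ x ∈ Ioo a b, ∀ y ∈ Ioo a b, x ≤ y → (∀ t ∈ Icc x y, w t ≠ 0) →
      ‖f x - f y‖ₑ ≤ ∫⁻ t in Ioc x y, h t)
    {x y : ℝ} (hx : x ∈ Ioo a b) (hy : y ∈ Ioo a b) (hxy : x ≤ y) :
    ‖f x - f y‖ₑ ≤ ∫⁻ t in Ioc x y, h t := by
  have hsub : ∀ {u v : ℝ}, u ∈ Ioo a b → v ∈ Ioo a b → Icc u v ⊆ Ioo a b :=
    fun hu hv t ht => ⟨hu.1.trans_le ht.1, ht.2.trans_lt hv.2⟩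
  -- intervals whose interior avoids the zero set
  have h2 : ∀ x ∈ Ioo a b, ∀ y ∈ Ioo a b, x ≤ y → (∀ t ∈ Ioo x y, w t ≠ 0) →
      ‖f x - f y‖ₑ ≤ ∫⁻ t in Ioc x y, h t := by
    intro x hx y hy hxy hne
    rcases hxy.eq_or_lt with rfl | hlt
    · simp
    have hx' : Filter.Tendsto f (nhdsWithin x (Ioi x)) (nhds (f x)) :=
      ((hf x hx).continuousAt (Ioo_mem_nhds hx.1 hx.2)).tendsto.mono_left nhdsWithin_le_nhds
    have hy' : Filter.Tendsto f (nhdsWithin y (Iio y)) (nhds (f y)) :=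
      ((hf y hy).continuousAt (Ioo_mem_nhds hy.1 hy.2)).tendsto.mono_left nhdsWithin_le_nhds
    have hstep : ∀ u ∈ Ioo x y, ‖f u - f y‖ₑ ≤ ∫⁻ t in Ioc x y, h t := by
      intro u hu
      have ht : Filter.Tendsto (fun v => ‖f u - f v‖ₑ) (nhdsWithin y (Iio y))
          (nhds ‖f u - f y‖ₑ) := (tendsto_const_nhds.sub hy').enorm
      refine le_of_tendsto ht ?_
      filter_upwards [Ioo_mem_nhdsLT hu.2] with v hv
      refine (h1 u (hsub hx hy ⟨hu.1.le, hu.2.le⟩) v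
        (hsub hx hy ⟨(hu.1.trans hv.1).le, hv.2.le⟩) hv.1.le fun t ht =>
          hne t ⟨hu.1.trans_le ht.1, ht.2.trans_lt hv.2⟩).trans ?_
      exact lintegral_mono_set (Ioc_subset_Ioc hu.1.le hv.2.le)
    have ht : Filter.Tendsto (fun u => ‖f u - f y‖ₑ) (nhdsWithin x (Ioi x))
        (nhds ‖f x - f y‖ₑ) := (hx'.sub tendsto_const_nhds).enorm
    refine le_of_tendsto ht ?_
    filter_upwards [Ioo_mem_nhdsGT hlt] with u hu using hstep u hu
  by_cases hne : ∀ t ∈ Ioo x y, w t ≠ 0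
  · exact h2 x hx y hy hxy hne
  · push Not at hne
    obtain ⟨c, hc, hwc⟩ := hne
    have hK : IsCompact (Icc x y ∩ w ⁻¹' {0}) :=
      isCompact_Icc.of_isClosed_subset ((hw.mono (hsub hx hy)).preimage_isClosed_of_isClosed
        isClosed_Icc isClosed_singleton) inter_subset_left
    have hKne : (Icc x y ∩ w ⁻¹' {0}).Nonempty := ⟨c, ⟨hc.1.le, hc.2.le⟩, hwc⟩
    -- Only the first and last zeros r ≤ s of w matter: between them the endpoint estimate `h0`
    -- ignores all the other zeros.
    obtain ⟨r, ⟨hr, hwr⟩, hrmin⟩ := hK.exists_isLeast hKne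
    obtain ⟨s, ⟨hs, hws⟩, hsmax⟩ := hK.exists_isGreatest hKne
    have hrs : r ≤ s := hrmin ⟨hs, hws⟩
    have e1 := h2 x hx r (hsub hx hy hr) hr.1 fun t ht h0 =>
      (ht.2.trans_le (hrmin ⟨⟨ht.1.le, ht.2.le.trans hr.2⟩, h0⟩)).false
    have e2 := h0 r (hsub hx hy hr) s (hsub hx hy hs) hrs hwr hws
    have e3 := h2 s (hsub hx hy hs) y hy hs.2 fun t ht h0 =>
      (ht.1.trans_le (hsmax ⟨⟨hs.1.trans ht.1.le, ht.2.le⟩, h0⟩)).false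
    calc ‖f x - f y‖ₑ = ‖(f x - f r) + (f r - f s) + (f s - f y)‖ₑ := by congr 1; ring
      _ ≤ ‖f x - f r‖ₑ + ‖f r - f s‖ₑ + ‖f s - f y‖ₑ :=
          (enorm_add_le _ _).trans (add_le_add_left (enorm_add_le _ _) _)
      _ ≤ (∫⁻ t in Ioc x r, h t) + (∫⁻ t in Ioc r s, h t) + ∫⁻ t in Ioc s y, h t := by gcongr
      _ = ∫⁻ t in Ioc x y, h t := by
          rw [lintegral_Ioc_add_le, Ioc_union_Ioc_eq_Ioc hr.1 hrs, lintegral_Ioc_add_le,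
            Ioc_union_Ioc_eq_Ioc (hr.1.trans hrs) hs.2]

/-- A continuous simple root of a differentiable depressed cubic is differentiable. -/
theorem hasDerivAt_simple_root {p q x : ℝ → ℂ} {p' q' : ℂ} {t : ℝ}
    (hp : HasDerivAt p p' t) (hq : HasDerivAt q q' t) (hx : ContinuousAt x t)
    (hroot : ∀ᶠ s in nhds t, x s ^ 3 + p s * x s + q s = 0) (hw : 3 * x t ^ 2 + p t ≠ 0) :
    HasDerivAt x (-(p' * x t + q') / (3 * x t ^ 2 + p t)) t := by
  rw [hasDerivAt_iff_tendsto_slope] at hp hq ⊢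
  have hx' : Filter.Tendsto x (nhdsWithin t {t}ᶜ) (nhds (x t)) :=
    hx.tendsto.mono_left nhdsWithin_le_nhds
  -- Subtracting the equations at s and t expresses the slope of x as a quotient with this
  -- denominator, which tends to the nonzero w.
  have hden : Filter.Tendsto (fun s => x s ^ 2 + x s * x t + x t ^ 2 + p t) (nhdsWithin t {t}ᶜ)
      (nhds (3 * x t ^ 2 + p t)) := by
    have : 3 * x t ^ 2 + p t = x t ^ 2 + x t * x t + x t ^ 2 + p t := by ring
    rw [this]
    exact (((hx'.pow 2).add (hx'.mul_const _)).add_const _).add_const _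
  have hnum := ((hp.mul hx').add hq).neg.div hden hw
  refine hnum.congr' ?_
  filter_upwards [hden.eventually_ne hw, nhdsWithin_le_nhds hroot] with s hs hrs
  have hrt := hroot.self_of_nhds
  simp only [slope_def_module, Pi.div_apply, Complex.real_smul]
  rw [div_eq_iff hs]
  linear_combination (((s - t)⁻¹ : ℝ) : ℂ) * (hrt - hrs)

/-- A continuous root of a depressed cubic varies by at most the integral of the derivatives of
radicals of the coefficients and of the discriminant. -/
theorem enorm_root_sub_le {p q p' q' x : ℝ → ℂ} {a b : ℝ}
    (hp : ∀ t ∈ Ioo a b, HasDerivAt p (p' t) t) (hq : ∀ t ∈ Ioo a b, HasDerivAt q (q' t) t)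
    (hp' : ContinuousOn p' (Ioo a b)) (hq' : ContinuousOn q' (Ioo a b))
    (hx : ContinuousOn x (Ioo a b)) (hroot : ∀ t ∈ Ioo a b, x t ^ 3 + p t * x t + q t = 0)
    {s t : ℝ} (hs : s ∈ Ioo a b) (ht : t ∈ Ioo a b) (hst : s ≤ t) :
    ‖x s - x t‖ₑ ≤ ∫⁻ r in Ioc s t, 4 * (rootDeriv 2 p p' r + rootDeriv 3 q q' r +
      rootDeriv 6 (fun s => 4 * p s ^ 3 + 27 * q s ^ 2)
        (fun s => 12 * p s ^ 2 * p' s + 54 * q s * q' s) r) := by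
  have hpc : ContinuousOn p (Ioo a b) := fun t ht => (hp t ht).continuousAt.continuousWithinAt
  have hwc : ContinuousOn (fun t => 3 * x t ^ 2 + p t) (Ioo a b) := by fun_prop
  have hsub : ∀ {u v : ℝ}, u ∈ Ioo a b → v ∈ Ioo a b → Icc u v ⊆ Ioo a b :=
    fun hu hv t ht => ⟨hu.1.trans_le ht.1, ht.2.trans_lt hv.2⟩
  refine enorm_sub_le_lintegral_of_glue hx hwc ?_ ?_ hs ht hst
  · intro s hs t ht hst hws hwt
    have hps : p s = -3 * x s ^ 2 := by linear_combination hws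
    have hpt : p t = -3 * x t ^ 2 := by linear_combination hwt
    have hqs : q s = 2 * x s ^ 3 := by linear_combination hroot s hs - x s * hws
    have hqt : q t = 2 * x t ^ 3 := by linear_combination hroot t ht - x t * hwt
    set m := max ‖x s‖ ‖x t‖ with hm
    have hsm : ‖x s‖ ≤ m := le_max_left _ _
    have htm : ‖x t‖ ≤ m := le_max_right _ _
    rcases (le_max_of_le_left (norm_nonneg _) : 0 ≤ m).eq_or_lt with hm0 | hm0
    · have h1 : x s = 0 := norm_le_zero_iff.1 (hm0 ▸ hsm)
      have h2 : x t = 0 := norm_le_zero_iff.1 (hm0 ▸ htm)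
      simp [h1, h2]
    have hd : ‖x s - x t‖ ≤ 2 * m := (norm_sub_le _ _).trans (by linarith)
    have hd0 : 0 ≤ ‖x s - x t‖ := norm_nonneg _
    have hfin : ∀ I : ℝ≥0∞, ENNReal.ofReal (‖x s - x t‖ / 4) ≤ I → ‖x s - x t‖ₑ ≤ 4 * I := by
      intro I hI
      calc ‖x s - x t‖ₑ = 4 * ENNReal.ofReal (‖x s - x t‖ / 4) := by
            rw [ENNReal.ofReal_div_of_pos (by norm_num), ofReal_norm]
            rw [show ENNReal.ofReal 4 = 4 by norm_num]
            exact (ENNReal.mul_div_cancel (by norm_num) (by norm_num)).symm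
        _ ≤ _ := by gcongr
    rw [lintegral_const_mul' _ _ (by norm_num)]
    apply hfin
    -- The increments of p and q contain x_s - x_t with cofactors x_s + x_t and x_s² + x_s x_t +
    -- x_t². These cannot both be small relative to m and m², so p or q detects the increment.
    by_cases hc : m / 2 ≤ ‖x s + x t‖
    · have hP : 3 / 2 * m * ‖x s - x t‖ ≤ ‖p s - p t‖ := by
        rw [hps, hpt, show -3 * x s ^ 2 - -3 * x t ^ 2 = -3 * ((x s + x t) * (x s - x t)) by ring,
          norm_mul, norm_mul]
        norm_num
        nlinarith
      refine le_trans (ENNReal.ofReal_le_ofReal ?_)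
        ((ofReal_min_le_lintegral_rootDeriv (k := 1) (f := p) (f' := p') (T := 3 * m) hst
          (fun r hr => hp r (hsub hs ht hr)) (hp'.mono (hsub hs ht)) (by positivity) ?_).trans
          (lintegral_mono fun r => by rw [add_assoc]; exact le_self_add))
      · rw [le_div_iff₀ (by positivity)]
        refine le_min ?_ ?_ <;> nlinarith
      · rw [hps, norm_mul, norm_pow]
        norm_num
        nlinarith [pow_le_pow_left₀ (norm_nonneg (x s)) hsm 2]
    · push Not at hc
      have hS : m ^ 2 / 2 ≤ ‖x s ^ 2 + x s * x t + x t ^ 2‖ := by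
        rcases max_choice ‖x s‖ ‖x t‖ with h | h
        · have e : x s ^ 2 + x s * x t + x t ^ 2 = x s ^ 2 - (-(x s + x t) * x t) := by ring
          have := norm_sub_norm_le (x s ^ 2) (-(x s + x t) * x t)
          rw [← e, norm_pow, norm_mul, norm_neg, ← h, ← hm] at this
          nlinarith [norm_nonneg (x s + x t), norm_nonneg (x t)]
        · have e : x s ^ 2 + x s * x t + x t ^ 2 = x t ^ 2 - (-(x s + x t) * x s) := by ring
          have := norm_sub_norm_le (x t ^ 2) (-(x s + x t) * x s)
          rw [← e, norm_pow, norm_mul, norm_neg, ← h, ← hm] at this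
          nlinarith [norm_nonneg (x s + x t), norm_nonneg (x s)]
      have hQ : m ^ 2 * ‖x s - x t‖ ≤ ‖q s - q t‖ := by
        rw [hqs, hqt, show 2 * x s ^ 3 - 2 * x t ^ 3 =
          2 * ((x s ^ 2 + x s * x t + x t ^ 2) * (x s - x t)) by ring, norm_mul, norm_mul]
        norm_num
        nlinarith
      refine le_trans (ENNReal.ofReal_le_ofReal ?_)
        ((ofReal_min_le_lintegral_rootDeriv (k := 2) (f := q) (f' := q') (T := 2 * m) hst
          (fun r hr => hq r (hsub hs ht hr)) (hq'.mono (hsub hs ht)) (by positivity) ?_).trans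
          (lintegral_mono fun r => le_trans le_add_self le_self_add))
      · rw [le_div_iff₀ (by positivity)]
        have := pow_pos hm0 2
        refine le_min ?_ ?_ <;> nlinarith
      · rw [hqs, norm_mul, norm_pow]
        norm_num
        nlinarith [pow_le_pow_left₀ (norm_nonneg (x s)) hsm 3, pow_pos hm0 3]
  · intro s hs t ht hst hne
    have hss := hsub hs ht
    have hder : ∀ r ∈ Icc s t, HasDerivAt x (-(p' r * x r + q' r) / (3 * x r ^ 2 + p r)) r := by
      intro r hr
      have hnh : Ioo a b ∈ nhds r := Ioo_mem_nhds (hss hr).1 (hss hr).2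
      exact hasDerivAt_simple_root (hp r (hss hr)) (hq r (hss hr)) (hx.continuousAt hnh)
        (Filter.mem_of_superset hnh hroot) (hne r hr)
    refine (enorm_sub_le_lintegral_of_hasDerivAt hst hder ?_).trans ?_
    · exact ((((hp'.mul hx).add hq').neg.mono hss).div (hwc.mono hss) hne)
    · refine setLIntegral_mono' measurableSet_Ioc fun r hr => ?_
      have hr' := Ioc_subset_Icc_self hr
      exact enorm_deriv_root_le (hroot r (hss hr')) (hne r hr') (div_mul_cancel₀ _ (hne r hr'))

/-! ### Weak-type estimate for real radicals. -/

/-- The auxiliary function `ε (u / R) v arctan (f / (ε v ^ (n + 1)))`, with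
`R = √(u² + δ²)` and `v = R ^ (1 / n)`. -/
noncomputable def radicalAux (n : ℕ) (ε δ f u : ℝ) : ℝ :=
  ε * (u / √(u ^ 2 + δ ^ 2)) * √(u ^ 2 + δ ^ 2) ^ (1 / n : ℝ) *
    Real.arctan (f / (ε * (√(u ^ 2 + δ ^ 2) ^ (1 / n : ℝ)) ^ (n + 1)))

theorem abs_arctan_le_two (s : ℝ) : |Real.arctan s| ≤ 2 := by
  rw [abs_le]
  constructor <;> linarith [Real.arctan_lt_pi_div_two s, Real.neg_pi_div_two_lt_arctan s,
    Real.pi_le_four]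

theorem abs_radicalAux_le {n : ℕ} {ε δ f u M : ℝ} (hε : 0 < ε) (hδ : 0 < δ) (hδ1 : δ ≤ 1)
    (hu : |u| ≤ M) :
    |radicalAux n ε δ f u| ≤ 2 * ε * (M + 1) ^ (1 / n : ℝ) := by
  unfold radicalAux
  set R := √(u ^ 2 + δ ^ 2) with hR
  have hR0 : 0 < R := by positivity
  have huR : |u| ≤ R := Real.abs_le_sqrt (by nlinarith)
  have hRM : R ≤ M + 1 := by
    rw [hR, Real.sqrt_le_left (by linarith [abs_nonneg u])]
    have := sq_abs u
    nlinarith [abs_nonneg u]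
  rw [abs_mul, abs_mul, abs_mul, abs_of_pos hε, abs_of_pos (Real.rpow_pos_of_pos hR0 _)]
  have h1 : |u / R| ≤ 1 := by
    rw [abs_div, abs_of_pos hR0]; exact div_le_one_of_le₀ huR hR0.le
  calc _ ≤ ε * 1 * (M + 1) ^ (1 / n : ℝ) * 2 := by
        have : 0 ≤ M + 1 := hR0.le.trans hRM
        gcongr
        exact abs_arctan_le_two _
    _ = _ := by ring

theorem hasDerivAt_radicalAux {n : ℕ} (hn : 1 ≤ n) {ε δ : ℝ} (hε : 0 < ε) (hδ : 0 < δ)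
    {f u g : ℝ → ℝ} {t : ℝ} (hf : HasDerivAt f (u t) t) (hu : HasDerivAt u (g t) t) :
    ∃ d, HasDerivAt (fun s => radicalAux n ε δ (f s) (u s)) d t ∧
      u t ^ 2 / (u t ^ 2 + δ ^ 2) *
        (1 + (f t / (ε * (√(u t ^ 2 + δ ^ 2) ^ (1 / n : ℝ)) ^ (n + 1))) ^ 2)⁻¹ ≤
      d + ε * (n + 5) * (|g t| / √(u t ^ 2 + δ ^ 2) ^ (1 - 1 / n : ℝ)) := by
  have hn0 : (0 : ℝ) < n := by exact_mod_cast hn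
  have hRd : HasDerivAt (fun s => √(u s ^ 2 + δ ^ 2)) (u t * g t / √(u t ^ 2 + δ ^ 2)) t := by
    have := ((hu.pow 2).add_const (δ ^ 2)).sqrt (by simp only [Pi.pow_apply]; positivity)
    convert! this using 1
    simp only [Pi.pow_apply]
    have : √(u t ^ 2 + δ ^ 2) ≠ 0 := by positivity
    field_simp
    norm_num
    ring
  set R := √(u t ^ 2 + δ ^ 2) with hR
  have hR0 : 0 < R := by positivity
  have hR2 : R ^ 2 = u t ^ 2 + δ ^ 2 := Real.sq_sqrt (by positivity)
  have huR : |u t| ≤ R := Real.abs_le_sqrt (by nlinarith)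
  set v := R ^ (1 / n : ℝ) with hv
  have hv0 : 0 < v := Real.rpow_pos_of_pos hR0 _
  have hvn : v ^ n = R := by
    rw [hv, ← Real.rpow_natCast, ← Real.rpow_mul hR0.le]; field_simp; simp
  have hvd : HasDerivAt (fun s => √(u s ^ 2 + δ ^ 2) ^ (1 / n : ℝ))
      (v * (u t * g t) / (n * R ^ 2)) t := by
    have := hRd.rpow_const (p := (1 / n : ℝ)) (Or.inl hR0.ne')
    convert! this using 1
    rw [← hR, Real.rpow_sub_one hR0.ne', ← hv]
    field_simp
  have hτd : HasDerivAt (fun s => u s / √(u s ^ 2 + δ ^ 2)) (g t * δ ^ 2 / R ^ 3) t := by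
    have := hu.div hRd hR0.ne'
    convert! this using 1
    rw [← hR]
    field_simp
    rw [hR2]; ring
  set s := f t / (ε * v ^ (n + 1)) with hs
  have hsd : HasDerivAt (fun s => f s / (ε * (√(u s ^ 2 + δ ^ 2) ^ (1 / n : ℝ)) ^ (n + 1)))
      (u t / (ε * v ^ (n + 1)) - (n + 1) * s * (u t * g t) / (n * R ^ 2)) t := by
    have := hf.div ((hvd.pow (n + 1)).const_mul ε)
      (by simp only [Pi.pow_apply]; positivity)
    convert! this using 1
    rw [← hR, ← hv, hs]
    simp only [Pi.pow_apply, Nat.add_sub_cancel]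
    rw [← hR, ← hv]
    push_cast
    field_simp
    ring
  have hΦ := ((hτd.const_mul ε).mul hvd).mul hsd.arctan
  refine ⟨_, hΦ, ?_⟩
  simp only [← hR, ← hv, ← hs, Pi.mul_apply, one_div (1 + s ^ 2)]
  set θ := Real.arctan s
  set b := (1 + s ^ 2)⁻¹ with hb
  have hθ : |θ| ≤ 2 := abs_arctan_le_two s
  have hb0 : 0 < b := by positivity
  have hsb : |s * b| ≤ 1 := by
    rw [abs_mul, abs_of_pos hb0, hb, ← div_eq_mul_inv]
    rw [div_le_one (by positivity)]
    nlinarith [sq_abs s, sq_nonneg (|s| - 1)]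
  have hvR : |g t| / R ^ (1 - 1 / n : ℝ) = |g t| * v / R := by
    rw [Real.rpow_sub hR0, Real.rpow_one, ← hv]; field_simp
  rw [hvR, ← hR2]
  -- As v^n = R, differentiating f inside the arctan yields exactly the main term u²b/R². Every
  -- other term contains ε g v/R, with a coefficient bounded by 2 + 2 + (n + 1).
  have e : u t ^ 2 / R ^ 2 * b - (ε * (g t * δ ^ 2 / R ^ 3) * v * θ
      + ε * (u t / R) * (v * (u t * g t) / (n * R ^ 2)) * θ
      + ε * (u t / R) * v * (b * (u t / (ε * v ^ (n + 1)) -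
        (n + 1) * s * (u t * g t) / (n * R ^ 2))))
      = ε * (g t * v / R) * (-(δ ^ 2 / R ^ 2) * θ - u t ^ 2 / R ^ 2 * (1 / n) * θ
        + u t ^ 2 / R ^ 2 * ((n + 1) / n) * (s * b)) := by
    rw [pow_succ v n, hvn]
    field_simp
    ring
  have h1 : |-(δ ^ 2 / R ^ 2) * θ - u t ^ 2 / R ^ 2 * (1 / n) * θ
        + u t ^ 2 / R ^ 2 * ((n + 1) / n) * (s * b)| ≤ (n : ℝ) + 5 := by
    have hn1 : (1 : ℝ) ≤ n := by exact_mod_cast hn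
    have a1 : δ ^ 2 / R ^ 2 ≤ 1 := by rw [div_le_one (by positivity), hR2]; nlinarith
    have a2 : u t ^ 2 / R ^ 2 ≤ 1 := by rw [div_le_one (by positivity), hR2]; nlinarith
    have a3 : (1 / n : ℝ) ≤ 1 := by rw [div_le_one hn0]; exact hn1
    have a4 : ((n + 1) / n : ℝ) ≤ n + 1 := div_le_self (by positivity) hn1
    have b1 : |-(δ ^ 2 / R ^ 2) * θ| ≤ 1 * 2 := by
      rw [abs_mul, abs_neg, abs_of_nonneg (by positivity)]; gcongr
    have b2 : |u t ^ 2 / R ^ 2 * (1 / n) * θ| ≤ 1 * 1 * 2 := by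
      rw [abs_mul, abs_of_nonneg (by positivity)]; gcongr
    have b3 : |u t ^ 2 / R ^ 2 * ((n + 1) / n) * (s * b)| ≤ 1 * ((n : ℝ) + 1) * 1 := by
      rw [abs_mul, abs_of_nonneg (by positivity)]; gcongr
    have := abs_add_le (-(δ ^ 2 / R ^ 2) * θ - u t ^ 2 / R ^ 2 * (1 / n) * θ)
      (u t ^ 2 / R ^ 2 * ((n + 1) / n) * (s * b))
    have := abs_sub (-(δ ^ 2 / R ^ 2) * θ) (u t ^ 2 / R ^ 2 * (1 / n) * θ)
    linarith
  have h2 := le_abs_self (ε * (g t * v / R) * (-(δ ^ 2 / R ^ 2) * θ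
      - u t ^ 2 / R ^ 2 * (1 / n) * θ + u t ^ 2 / R ^ 2 * ((n + 1) / n) * (s * b)))
  rw [abs_mul, abs_mul, abs_of_pos hε, abs_div, abs_mul, abs_of_pos hv0, abs_of_pos hR0] at h2
  have h3 : ε * (|g t| * v / R) * |-(δ ^ 2 / R ^ 2) * θ - u t ^ 2 / R ^ 2 * (1 / n) * θ
        + u t ^ 2 / R ^ 2 * ((n + 1) / n) * (s * b)| ≤ ε * (|g t| * v / R) * (n + 5) := by
    gcongr
  linarith

theorem ofReal_div_sqrt_rpow_le_rootDeriv {n : ℕ} (hn : 1 ≤ n) {u g : ℝ → ℝ} {t δ : ℝ}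
    (hδ : 0 < δ) :
    ENNReal.ofReal (|g t| / √(u t ^ 2 + δ ^ 2) ^ (1 - 1 / n : ℝ)) ≤ rootDeriv n u g t := by
  unfold rootDeriv
  have hR0 : 0 < √(u t ^ 2 + δ ^ 2) := by positivity
  have he : (0 : ℝ) ≤ 1 - 1 / n := by
    rw [sub_nonneg, div_le_one (by exact_mod_cast hn)]; exact_mod_cast hn
  rw [ENNReal.ofReal_div_of_pos (by positivity), ← Real.norm_eq_abs, ofReal_norm,
    ← ENNReal.ofReal_rpow_of_pos hR0]
  gcongr
  rw [← ofReal_norm]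
  exact ENNReal.ofReal_le_ofReal (Real.abs_le_sqrt (by nlinarith))

theorem lintegral_arctan_deriv_le {n : ℕ} (hn : 1 ≤ n) {ε δ M x y : ℝ} (hε : 0 < ε) (hδ : 0 < δ)
    (hδ1 : δ ≤ 1) (hxy : x ≤ y) {f u g : ℝ → ℝ}
    (hf : ∀ t ∈ Icc x y, HasDerivAt f (u t) t) (hu : ∀ t ∈ Icc x y, HasDerivAt u (g t) t)
    (hg : ContinuousOn g (Icc x y)) (hM : ∀ t ∈ Icc x y, |u t| ≤ M) :
    ∫⁻ t in Icc x y, ENNReal.ofReal (u t ^ 2 / (u t ^ 2 + δ ^ 2) *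
        (1 + (f t / (ε * (√(u t ^ 2 + δ ^ 2) ^ (1 / n : ℝ)) ^ (n + 1))) ^ 2)⁻¹) ≤
      ENNReal.ofReal ε * (ENNReal.ofReal (4 * (M + 1) ^ (1 / n : ℝ)) +
        ENNReal.ofReal (n + 5) * ∫⁻ t in Icc x y, rootDeriv n u g t) := by
  have hfc : ContinuousOn f (Icc x y) := fun t ht => (hf t ht).continuousAt.continuousWithinAt
  have huc : ContinuousOn u (Icc x y) := fun t ht => (hu t ht).continuousAt.continuousWithinAt
  have hRc : ContinuousOn (fun t => √(u t ^ 2 + δ ^ 2)) (Icc x y) := by fun_prop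
  have hR0 : ∀ t, 0 < √(u t ^ 2 + δ ^ 2) := fun t => by positivity
  have hvc : ∀ e : ℝ, ContinuousOn (fun t => √(u t ^ 2 + δ ^ 2) ^ e) (Icc x y) := fun e =>
    hRc.rpow_const fun t _ => Or.inl (hR0 t).ne'
  have hv0 : ∀ (e : ℝ) t, 0 < √(u t ^ 2 + δ ^ 2) ^ e := fun e t => Real.rpow_pos_of_pos (hR0 t) _
  set F : ℝ → ℝ := fun t => u t ^ 2 / (u t ^ 2 + δ ^ 2) *
        (1 + (f t / (ε * (√(u t ^ 2 + δ ^ 2) ^ (1 / n : ℝ)) ^ (n + 1))) ^ 2)⁻¹ with hF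
  set G : ℝ → ℝ := fun t => ε * (n + 5) * (|g t| / √(u t ^ 2 + δ ^ 2) ^ (1 - 1 / n : ℝ)) with hG
  have hFc : ContinuousOn F (Icc x y) := by
    refine ContinuousOn.mul (ContinuousOn.div (by fun_prop) (by fun_prop)
      fun t _ => by positivity) (ContinuousOn.inv₀ ?_ fun t _ => by positivity)
    refine continuousOn_const.add (ContinuousOn.pow (hfc.div
      (continuousOn_const.mul ((hvc _).pow _)) fun t _ => ?_) 2)
    exact (mul_pos hε (pow_pos (hv0 (1 / n) t) _)).ne'
  have hGc : ContinuousOn G (Icc x y) :=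
    continuousOn_const.mul (hg.abs.div (hvc _) fun t _ => (hv0 _ t).ne')
  have hFi : IntegrableOn F (Icc x y) := hFc.integrableOn_Icc
  have hGi : IntegrableOn G (Icc x y) := hGc.integrableOn_Icc
  have hF0 : ∀ t, 0 ≤ F t := fun t => by simp only [hF]; positivity
  have hG0 : ∀ t, 0 ≤ G t := fun t => by
    have := hv0 (1 - 1 / n) t
    simp only [hG]; positivity
  choose! d hd hdle using fun t (ht : t ∈ Icc x y) =>
    hasDerivAt_radicalAux hn hε hδ (hf t ht) (hu t ht)
  have hint : ∫ t in x..y, (F t - G t) ≤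
      radicalAux n ε δ (f y) (u y) - radicalAux n ε δ (f x) (u x) := by
    -- This one-sided form needs only a continuous minorant of the derivative `d`, not integrability
    -- of `d`.
    refine intervalIntegral.integral_le_sub_of_hasDeriv_right_of_le (g' := d)
      (g := fun s => radicalAux n ε δ (f s) (u s)) hxy
      (fun t ht => (hd t ht).continuousAt.continuousWithinAt)
      (fun t ht => (hd t (Ioo_subset_Icc_self ht)).hasDerivWithinAt) (hFi.sub hGi) fun t ht => ?_
    rw [sub_le_iff_le_add]
    exact hdle t (Ioo_subset_Icc_self ht)
  rw [intervalIntegral.integral_of_le hxy, ← integral_Icc_eq_integral_Ioc,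
    integral_sub hFi hGi] at hint
  have hΦy := (abs_le.1 (abs_radicalAux_le (n := n) (f := f y) hε hδ hδ1
    (hM y (right_mem_Icc.2 hxy)))).2
  have hΦx := (abs_le.1 (abs_radicalAux_le (n := n) (f := f x) hε hδ hδ1
    (hM x (left_mem_Icc.2 hxy)))).1
  have hM0 : 0 ≤ M := (abs_nonneg _).trans (hM x (left_mem_Icc.2 hxy))
  have hfin : ∫ t in Icc x y, F t ≤ ε * (4 * (M + 1) ^ (1 / n : ℝ)) + ∫ t in Icc x y, G t := by
    linarith
  calc ∫⁻ t in Icc x y, ENNReal.ofReal (F t) = ENNReal.ofReal (∫ t in Icc x y, F t) :=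
        (ofReal_integral_eq_lintegral_ofReal hFi (Filter.Eventually.of_forall hF0)).symm
    _ ≤ ENNReal.ofReal (ε * (4 * (M + 1) ^ (1 / n : ℝ)) + ∫ t in Icc x y, G t) :=
        ENNReal.ofReal_le_ofReal hfin
    _ = ENNReal.ofReal ε * ENNReal.ofReal (4 * (M + 1) ^ (1 / n : ℝ)) +
          ∫⁻ t in Icc x y, ENNReal.ofReal (G t) := by
        rw [ENNReal.ofReal_add (by positivity) (integral_nonneg hG0),
          ENNReal.ofReal_mul hε.le,
          ofReal_integral_eq_lintegral_ofReal hGi (Filter.Eventually.of_forall hG0)]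
    _ ≤ ENNReal.ofReal ε * ENNReal.ofReal (4 * (M + 1) ^ (1 / n : ℝ)) +
          ∫⁻ t in Icc x y, ENNReal.ofReal ε * ENNReal.ofReal (n + 5) * rootDeriv n u g t := by
        gcongr with t
        simp only [hG]
        rw [ENNReal.ofReal_mul (by positivity), ENNReal.ofReal_mul hε.le]
        gcongr
        exact ofReal_div_sqrt_rpow_le_rootDeriv hn hδ
    _ = _ := by
        rw [lintegral_const_mul' _ _ (ENNReal.mul_ne_top ENNReal.ofReal_ne_top
          ENNReal.ofReal_ne_top), mul_assoc, mul_add]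

/-- The set is where the arctan expression is forced to grow, while its total increment is O(ε) on
every compact subinterval. -/
theorem volume_abs_lt_mul_rpow_le {n : ℕ} (hn : 1 ≤ n) {ε M a b : ℝ} (hε : 0 < ε)
    {f u g : ℝ → ℝ}
    (hf : ∀ t ∈ Ioo a b, HasDerivAt f (u t) t) (hu : ∀ t ∈ Ioo a b, HasDerivAt u (g t) t)
    (hg : ContinuousOn g (Ioo a b)) (hM : ∀ t ∈ Ioo a b, |u t| ≤ M) :
    volume {t ∈ Ioo a b | |f t| < ε * |u t| ^ ((n + 1) / n : ℝ)} ≤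
      4 * (ENNReal.ofReal ε * (ENNReal.ofReal (4 * (M + 1) ^ (1 / n : ℝ)) +
        ENNReal.ofReal (n + 5) * ∫⁻ t in Ioo a b, rootDeriv n u g t)) := by
  have hn0 : (0 : ℝ) < n := by exact_mod_cast hn
  set K := ENNReal.ofReal ε * (ENNReal.ofReal (4 * (M + 1) ^ (1 / n : ℝ)) +
        ENNReal.ofReal (n + 5) * ∫⁻ t in Ioo a b, rootDeriv n u g t) with hK
  -- The same δ = 1/(m+1) bounds |u| and the distance to the endpoints from below, and regularizes
  -- |u|. The sets exhaust the target because its strict inequality excludes u = 0.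
  set S : ℕ → Set ℝ := fun m => {t | a + 1 / (m + 1 : ℝ) ≤ t ∧ t ≤ b - 1 / (m + 1 : ℝ) ∧
    1 / (m + 1 : ℝ) ≤ |u t| ∧ |f t| < ε * |u t| ^ ((n + 1) / n : ℝ)} with hS
  have hmono : Monotone S := by
    intro m k hmk t ht
    have : 1 / (k + 1 : ℝ) ≤ 1 / (m + 1 : ℝ) := by gcongr
    exact ⟨by linarith [ht.1], by linarith [ht.2.1], by linarith [ht.2.2.1], ht.2.2.2⟩
  have hcov : {t ∈ Ioo a b | |f t| < ε * |u t| ^ ((n + 1) / n : ℝ)} ⊆ ⋃ m, S m := by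
    rintro t ⟨ht, hlt⟩
    have hut : 0 < |u t| := by
      by_contra! h
      have : |u t| = 0 := le_antisymm h (abs_nonneg _)
      rw [this, Real.zero_rpow (by positivity), mul_zero] at hlt
      exact absurd hlt (abs_nonneg _).not_gt
    have hpos : 0 < min (min (t - a) (b - t)) |u t| :=
      lt_min (lt_min (sub_pos.2 ht.1) (sub_pos.2 ht.2)) hut
    obtain ⟨m, hm⟩ := exists_nat_one_div_lt hpos
    rw [lt_min_iff, lt_min_iff] at hm
    exact mem_iUnion.2 ⟨m, by linarith [hm.1.1], by linarith [hm.1.2], hm.2.le, hlt⟩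
  refine (measure_mono hcov).trans ?_
  rw [hmono.measure_iUnion]
  refine iSup_le fun m => ?_
  set δ : ℝ := 1 / (m + 1 : ℝ) with hδ
  have hδ0 : 0 < δ := by positivity
  have hδ1 : δ ≤ 1 := by
    rw [hδ, div_le_one (by positivity)]; linarith [(Nat.cast_nonneg m : (0 : ℝ) ≤ m)]
  rcases lt_or_ge (b - δ) (a + δ) with hlt | hle
  · have : S m = ∅ := eq_empty_of_forall_notMem fun t ht => by linarith [ht.1, ht.2.1]
    simp [this]
  have hsub : Icc (a + δ) (b - δ) ⊆ Ioo a b := fun t ht =>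
    ⟨by linarith [ht.1], by linarith [ht.2]⟩
  have hmain := lintegral_arctan_deriv_le hn hε hδ0 hδ1 hle (fun t ht => hf t (hsub ht))
    (fun t ht => hu t (hsub ht)) (hg.mono hsub) (fun t ht => hM t (hsub ht))
  have hmain' := hmain.trans (b := _) (c := K) (by
    rw [hK]; gcongr)
  have hfc : ContinuousOn f (Icc (a + δ) (b - δ)) :=
    fun t ht => (hf t (hsub ht)).continuousAt.continuousWithinAt
  have huc : ContinuousOn u (Icc (a + δ) (b - δ)) :=
    fun t ht => (hu t (hsub ht)).continuousAt.continuousWithinAt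
  have hSm : MeasurableSet (S m) := by
    have h1 : S m = (Icc (a + δ) (b - δ) ∩ u ⁻¹' {s | δ ≤ |s|}) ∩
        (Ioo a b ∩ (fun t => ε * |u t| ^ ((n + 1) / n : ℝ) - |f t|) ⁻¹' Ioi 0) := by
      ext t
      simp only [hS, mem_inter_iff, mem_Icc, mem_preimage, mem_Ioo, mem_Ioi, sub_pos]
      constructor
      · rintro ⟨h1, h2, h3, h4⟩
        exact ⟨⟨⟨h1, h2⟩, h3⟩, hsub ⟨h1, h2⟩, h4⟩
      · rintro ⟨⟨⟨h1, h2⟩, h3⟩, -, h4⟩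
        exact ⟨h1, h2, h3, h4⟩
    rw [h1]
    refine ((huc.preimage_isClosed_of_isClosed isClosed_Icc
      (isClosed_le continuous_const continuous_abs)).measurableSet).inter
      (ContinuousOn.isOpen_inter_preimage ?_ isOpen_Ioo isOpen_Ioi).measurableSet
    have hfo : ContinuousOn f (Ioo a b) := fun t ht => (hf t ht).continuousAt.continuousWithinAt
    have huo : ContinuousOn u (Ioo a b) := fun t ht => (hu t ht).continuousAt.continuousWithinAt
    exact (continuousOn_const.mul (huo.abs.rpow_const fun t _ => Or.inr (by positivity))).sub
      hfo.abs
  have hSI : S m ⊆ Icc (a + δ) (b - δ) := fun t ht => ⟨ht.1, ht.2.1⟩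
  -- On `S m`, δ ≤ |u| makes the first factor at least 1/2, and an arctan argument of modulus at
  -- most 1 does the same for the second.
  have hquarter : ENNReal.ofReal (1 / 4) * volume (S m) ≤ K := by
    rw [← setLIntegral_const]
    refine le_trans (setLIntegral_mono' (g := fun t => ENNReal.ofReal
      (u t ^ 2 / (u t ^ 2 + δ ^ 2) *
        (1 + (f t / (ε * (√(u t ^ 2 + δ ^ 2) ^ (1 / n : ℝ)) ^ (n + 1))) ^ 2)⁻¹)) hSm
        fun t ht => ?_)
      ((lintegral_mono_set hSI).trans hmain')
    refine ENNReal.ofReal_le_ofReal ?_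
    have hR0 : 0 < √(u t ^ 2 + δ ^ 2) := by positivity
    have huR : |u t| ≤ √(u t ^ 2 + δ ^ 2) := Real.abs_le_sqrt (by nlinarith)
    have h3 : δ ^ 2 ≤ u t ^ 2 := by rw [← sq_abs (u t)]; exact pow_le_pow_left₀ hδ0.le ht.2.2.1 2
    have e1 : 1 / 2 ≤ u t ^ 2 / (u t ^ 2 + δ ^ 2) := by
      rw [le_div_iff₀ (by positivity)]; linarith
    have hv : |u t| ^ ((n + 1) / n : ℝ) ≤ (√(u t ^ 2 + δ ^ 2) ^ (1 / n : ℝ)) ^ (n + 1) := by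
      rw [← Real.rpow_natCast, ← Real.rpow_mul hR0.le]
      have : (1 / n : ℝ) * ((n + 1 : ℕ) : ℝ) = (n + 1) / n := by push_cast; field_simp
      rw [this]
      exact Real.rpow_le_rpow (abs_nonneg _) huR (by positivity)
    have hs : |f t / (ε * (√(u t ^ 2 + δ ^ 2) ^ (1 / n : ℝ)) ^ (n + 1))| ≤ 1 := by
      have hpos : 0 < ε * (√(u t ^ 2 + δ ^ 2) ^ (1 / n : ℝ)) ^ (n + 1) := by positivity
      rw [abs_div, abs_of_pos hpos, div_le_one hpos]
      exact ht.2.2.2.le.trans (by gcongr)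
    have e2 : 1 / 2 ≤ (1 + (f t / (ε * (√(u t ^ 2 + δ ^ 2) ^ (1 / n : ℝ)) ^ (n + 1))) ^ 2)⁻¹ := by
      rw [one_div]
      gcongr
      have := (sq_le_one_iff_abs_le_one _).2 hs
      linarith
    calc (1 / 4 : ℝ) = 1 / 2 * (1 / 2) := by norm_num
      _ ≤ _ := by gcongr
  calc volume (S m) = 4 * (ENNReal.ofReal (1 / 4) * volume (S m)) := by
        rw [← mul_assoc, ENNReal.ofReal_div_of_pos (by norm_num)]
        norm_num
        rw [ENNReal.mul_inv_cancel (by norm_num) (by norm_num), one_mul]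
    _ ≤ 4 * K := by gcongr

theorem volume_lt_rootDeriv_le {n : ℕ} (hn : 1 ≤ n) {r M a b : ℝ} (hr : 0 < r)
    {f u g : ℝ → ℝ}
    (hf : ∀ t ∈ Ioo a b, HasDerivAt f (u t) t) (hu : ∀ t ∈ Ioo a b, HasDerivAt u (g t) t)
    (hg : ContinuousOn g (Ioo a b)) (hM : ∀ t ∈ Ioo a b, |u t| ≤ M) :
    volume {t ∈ Ioo a b | ENNReal.ofReal r < rootDeriv (n + 1) f u t} ≤
      4 * (ENNReal.ofReal (4 * (M + 1) ^ (1 / n : ℝ)) +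
        ENNReal.ofReal (n + 5) * ∫⁻ t in Ioo a b, rootDeriv n u g t) *
        ENNReal.ofReal (r ^ (-((n + 1) / n : ℝ))) := by
  have hn0 : (0 : ℝ) < n := by exact_mod_cast hn
  -- Solving |u|/|f|^(n/(n+1)) > r for |f| dictates this ε.
  have h := volume_abs_lt_mul_rpow_le hn (ε := r ^ (-((n + 1) / n : ℝ)))
    (Real.rpow_pos_of_pos hr _) hf hu hg hM
  rw [mul_comm (ENNReal.ofReal _), ← mul_assoc] at h
  refine (measure_mono ?_).trans h
  rintro t ⟨ht, hlt⟩
  refine ⟨ht, ?_⟩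
  by_contra! hle
  refine absurd hlt (not_lt.2 ?_)
  unfold rootDeriv
  refine ENNReal.div_le_of_le_mul ?_
  have he : (1 : ℝ) - 1 / ((n + 1 : ℕ) : ℝ) = n / (n + 1) := by
    push_cast; field_simp; ring
  rw [he, ← ofReal_norm, ← ofReal_norm, ENNReal.ofReal_rpow_of_nonneg (norm_nonneg _)
    (by positivity), ← ENNReal.ofReal_mul hr.le]
  refine ENNReal.ofReal_le_ofReal ?_
  rw [Real.norm_eq_abs, Real.norm_eq_abs]
  have h2 := Real.rpow_le_rpow (by positivity) hle (by positivity : (0 : ℝ) ≤ n / (n + 1))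
  rw [Real.mul_rpow (by positivity) (by positivity), ← Real.rpow_mul hr.le,
    ← Real.rpow_mul (abs_nonneg _)] at h2
  have e1 : ((n + 1) / n : ℝ) * (n / (n + 1)) = 1 := by field_simp
  rw [neg_mul, e1, Real.rpow_neg_one, Real.rpow_one, inv_mul_le_iff₀ hr] at h2
  exact h2

/-- Layer-cake formula split at level 1: below it the total mass suffices, above it the weak bound
is integrable because q < p. -/
theorem exists_lintegral_rpow_le_of_weak {p q : ℝ} (hq : 0 < q) (hqp : q < p) {K V : ℝ≥0∞}
    (hK : K ≠ ⊤) (hV : V ≠ ⊤) :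
    ∃ B : ℝ≥0∞, B ≠ ⊤ ∧ ∀ (μ : Measure ℝ) (h : ℝ → ℝ≥0∞), AEMeasurable h μ → μ univ ≤ V →
      (∀ r : ℝ, 0 < r → μ {t | ENNReal.ofReal r < h t} ≤ K * ENNReal.ofReal (r ^ (-p))) →
      ∫⁻ t, h t ^ q ∂μ ≤ B := by
  have c1 : ∫⁻ r in Ioc (0 : ℝ) 1, ENNReal.ofReal (r ^ (q - 1)) ≠ ⊤ := by
    have : IntegrableOn (fun r : ℝ => r ^ (q - 1)) (Ioc 0 1) :=
      (intervalIntegrable_iff_integrableOn_Ioc_of_le zero_le_one).1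
        (intervalIntegral.intervalIntegrable_rpow' (by linarith))
    exact this.lintegral_lt_top.ne
  have c2 : ∫⁻ r in Ioi (1 : ℝ), ENNReal.ofReal (r ^ (q - 1 - p)) ≠ ⊤ :=
    (integrableOn_Ioi_rpow_of_lt (by linarith) zero_lt_one).lintegral_lt_top.ne
  refine ⟨ENNReal.ofReal q * (V * (∫⁻ r in Ioc (0 : ℝ) 1, ENNReal.ofReal (r ^ (q - 1))) +
    K * ∫⁻ r in Ioi (1 : ℝ), ENNReal.ofReal (r ^ (q - 1 - p))),
    ENNReal.mul_ne_top ENNReal.ofReal_ne_top (ENNReal.add_ne_top.2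
      ⟨ENNReal.mul_ne_top hV c1, ENNReal.mul_ne_top hK c2⟩), fun μ h hm hμ hw => ?_⟩
  -- The set where h is infinite lies in all superlevel sets, whose measures tend to 0.
  have hfin : ∀ᵐ t ∂μ, h t ≠ ⊤ := by
    rw [ae_iff]
    have hlim : Filter.Tendsto (fun r : ℝ => K * ENNReal.ofReal (r ^ (-p))) Filter.atTop
        (nhds 0) := by
      have := ENNReal.Tendsto.const_mul (ENNReal.tendsto_ofReal
        (tendsto_rpow_neg_atTop (hq.trans hqp))) (Or.inr hK)
      simpa using this
    refine le_antisymm (ge_of_tendsto hlim ?_) zero_le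
    filter_upwards [Filter.eventually_gt_atTop (0 : ℝ)] with r hr
    refine (measure_mono fun t ht => ?_).trans (hw r hr)
    have : h t = ⊤ := not_not.1 ht
    simp [this]
  have e1 : ∫⁻ t, h t ^ q ∂μ = ∫⁻ t, ENNReal.ofReal ((h t).toReal ^ q) ∂μ := by
    refine lintegral_congr_ae ?_
    filter_upwards [hfin] with t ht
    rw [← ENNReal.ofReal_rpow_of_nonneg ENNReal.toReal_nonneg hq.le, ENNReal.ofReal_toReal ht]
  rw [e1, lintegral_rpow_eq_lintegral_meas_lt_mul μ (Filter.Eventually.of_forall fun t =>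
    ENNReal.toReal_nonneg) hm.ennreal_toReal hq, ← Ioc_union_Ioi_eq_Ioi (zero_le_one' ℝ),
    lintegral_union measurableSet_Ioi (Ioc_disjoint_Ioi le_rfl)]
  gcongr
  · rw [← lintegral_const_mul' _ _ hV]
    refine setLIntegral_mono' measurableSet_Ioc fun r hr => ?_
    gcongr
    exact (measure_mono (subset_univ _)).trans hμ
  · rw [← lintegral_const_mul' _ _ hK]
    refine setLIntegral_mono' measurableSet_Ioi fun r hr => ?_
    have hr0 : 0 < r := zero_lt_one.trans hr
    have : r ^ (q - 1 - p) = r ^ (-p) * r ^ (q - 1) := by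
      rw [← Real.rpow_add hr0]; ring_nf
    rw [this, ENNReal.ofReal_mul (by positivity), ← mul_assoc]
    gcongr
    refine (measure_mono fun t ht => ?_).trans (hw r hr0)
    exact (ENNReal.ofReal_lt_ofReal_iff_of_nonneg hr0.le).2 ht |>.trans_le ENNReal.ofReal_toReal_le

/-! ### Calculus of functions with bounded derivatives. -/

/-- On `(a, b)` the function `f` is `n` times continuously differentiable, and `f` and its
derivatives of order at most `n` are bounded by `M`. -/
def HasDerivBounds {E : Type*} [NormedAddCommGroup E] [NormedSpace ℝ E] (M a b : ℝ) :
    ℕ → (ℝ → E) → Prop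
  | 0, f => (∀ t ∈ Ioo a b, ‖f t‖ ≤ M) ∧ ContinuousOn f (Ioo a b)
  | n + 1, f => (∀ t ∈ Ioo a b, ‖f t‖ ≤ M) ∧
      ∃ g : ℝ → E, (∀ t ∈ Ioo a b, HasDerivAt f (g t) t) ∧ HasDerivBounds M a b n g

namespace HasDerivBounds

section
variable {E : Type*} [NormedAddCommGroup E] [NormedSpace ℝ E] {M N a b : ℝ} {n m : ℕ} {f g : ℝ → E}

theorem norm_le (h : HasDerivBounds M a b n f) : ∀ t ∈ Ioo a b, ‖f t‖ ≤ M := by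
  cases n <;> exact h.1

theorem continuousOn (h : HasDerivBounds M a b n f) : ContinuousOn f (Ioo a b) := by
  cases n with
  | zero => exact h.2
  | succ n =>
    obtain ⟨-, g, hg, -⟩ := h
    exact fun t ht => (hg t ht).continuousAt.continuousWithinAt

theorem of_succ (h : HasDerivBounds M a b (n + 1) f) : HasDerivBounds M a b n f := by
  induction n generalizing f with
  | zero => exact ⟨h.1, h.continuousOn⟩
  | succ n ih =>
    obtain ⟨h1, g, hg, h2⟩ := h
    exact ⟨h1, g, hg, ih h2⟩

theorem of_le (h : HasDerivBounds M a b n f) (hmn : m ≤ n) : HasDerivBounds M a b m f := by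
  induction n, hmn using Nat.le_induction with
  | base => exact h
  | succ n _ ih => exact ih h.of_succ

theorem mono (h : HasDerivBounds M a b n f) (hMN : M ≤ N) : HasDerivBounds N a b n f := by
  induction n generalizing f with
  | zero => exact ⟨fun t ht => (h.1 t ht).trans hMN, h.2⟩
  | succ n ih =>
    obtain ⟨h1, g, hg, h2⟩ := h
    exact ⟨fun t ht => (h1 t ht).trans hMN, g, hg, ih h2⟩

theorem add (hf : HasDerivBounds M a b n f) (hg : HasDerivBounds N a b n g) :
    HasDerivBounds (M + N) a b n (fun t => f t + g t) := by
  induction n generalizing f g with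
  | zero => exact ⟨fun t ht => norm_add_le_of_le (hf.1 t ht) (hg.1 t ht), hf.2.add hg.2⟩
  | succ n ih =>
    obtain ⟨h1, f', hf', h2⟩ := hf
    obtain ⟨k1, g', hg', k2⟩ := hg
    exact ⟨fun t ht => norm_add_le_of_le (h1 t ht) (k1 t ht), _,
      fun t ht => (hf' t ht).add (hg' t ht), ih h2 k2⟩

theorem comp_clm {F : Type*} [NormedAddCommGroup F] [NormedSpace ℝ F] (L : E →L[ℝ] F)
    (hL : ∀ x, ‖L x‖ ≤ ‖x‖) (hf : HasDerivBounds M a b n f) :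
    HasDerivBounds M a b n (fun t => L (f t)) := by
  induction n generalizing f with
  | zero => exact ⟨fun t ht => (hL _).trans (hf.1 t ht), L.continuous.comp_continuousOn hf.2⟩
  | succ n ih =>
    obtain ⟨h1, f', hf', h2⟩ := hf
    exact ⟨fun t ht => (hL _).trans (h1 t ht), _,
      fun t ht => L.hasFDerivAt.comp_hasDerivAt t (hf' t ht), ih h2⟩

theorem of_contDiffOn (hf : ContDiffOn ℝ n f (Ioo a b))
    (hM : ∀ j ≤ n, ∀ t ∈ Ioo a b, ‖iteratedDerivWithin j f (Ioo a b) t‖ ≤ M) :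
    HasDerivBounds M a b n f := by
  induction n generalizing f with
  | zero => exact ⟨by simpa using hM 0 le_rfl, hf.continuousOn⟩
  | succ n ih =>
    refine ⟨by simpa using hM 0 (Nat.zero_le _), derivWithin f (Ioo a b), fun t ht => ?_, ih ?_ ?_⟩
    · exact (((hf.differentiableOn (by simp)) t ht).hasDerivWithinAt).hasDerivAt
        (Ioo_mem_nhds ht.1 ht.2)
    · exact hf.derivWithin (uniqueDiffOn_Ioo a b) (by norm_cast)
    · intro j hj t ht
      have := hM (j + 1) (by omega) t ht
      rwa [iteratedDerivWithin_succ'] at this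

end

variable {M N a b : ℝ} {n : ℕ} {f g : ℝ → ℂ}

theorem const_mul (c : ℂ) (hf : HasDerivBounds M a b n f) :
    HasDerivBounds (‖c‖ * M) a b n (fun t => c * f t) := by
  have hb : ∀ {f : ℝ → ℂ}, (∀ t ∈ Ioo a b, ‖f t‖ ≤ M) → ∀ t ∈ Ioo a b, ‖c * f t‖ ≤ ‖c‖ * M :=
    fun h t ht => by rw [norm_mul]; gcongr; exact h t ht
  induction n generalizing f with
  | zero => exact ⟨hb hf.1, continuousOn_const.mul hf.2⟩
  | succ n ih =>
    obtain ⟨h1, f', hf', h2⟩ := hf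
    exact ⟨hb h1, _, fun t ht => (hf' t ht).const_mul c, ih h2⟩

theorem mul (hM : 0 ≤ M) (hN : 0 ≤ N) (hf : HasDerivBounds M a b n f)
    (hg : HasDerivBounds N a b n g) :
    HasDerivBounds (2 ^ n * M * N) a b n (fun t => f t * g t) := by
  have hb : ∀ {f g : ℝ → ℂ}, (∀ t ∈ Ioo a b, ‖f t‖ ≤ M) → (∀ t ∈ Ioo a b, ‖g t‖ ≤ N) →
      ∀ n : ℕ, ∀ t ∈ Ioo a b, ‖f t * g t‖ ≤ 2 ^ n * M * N := by
    intro f g hf hg n t ht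
    calc ‖f t * g t‖ ≤ M * N := by
          rw [norm_mul]; gcongr
          · exact hf t ht
          · exact hg t ht
      _ ≤ 2 ^ n * (M * N) := le_mul_of_one_le_left (by positivity) (one_le_pow₀ one_le_two)
      _ = _ := by ring
  induction n generalizing f g with
  | zero => exact ⟨hb hf.1 hg.1 0, hf.2.mul hg.2⟩
  | succ n ih =>
    have hf0 := hf.of_succ
    have hg0 := hg.of_succ
    obtain ⟨h1, f', hf', h2⟩ := hf
    obtain ⟨k1, g', hg', k2⟩ := hg
    refine ⟨hb h1 k1 (n + 1), _, fun t ht => (hf' t ht).mul (hg' t ht), ?_⟩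
    convert! (ih h2 hg0).add (ih hf0 k2) using 1
    ring

end HasDerivBounds

/-! ### Induction on the order of the radical. -/

theorem aemeasurable_rootDeriv {E : Type*} [NormedAddCommGroup E] {k : ℕ} {f g : ℝ → E} {a b : ℝ}
    (hf : ContinuousOn f (Ioo a b)) (hg : ContinuousOn g (Ioo a b)) :
    AEMeasurable (rootDeriv k f g) (volume.restrict (Ioo a b)) :=
  ((hg.aestronglyMeasurable measurableSet_Ioo).enorm).div
    (((hf.aestronglyMeasurable measurableSet_Ioo).enorm).pow_const _)

/-- Applying the integral bound to the pair (f', f'') controls the error term in the measure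
estimate for (f, f'). -/
theorem exists_volume_lt_rootDeriv_le_of_lintegral {a b M : ℝ} {n : ℕ} {B : ℝ≥0∞} (hB : B ≠ ⊤)
    (h : ∀ f u : ℝ → ℝ, (∀ t ∈ Ioo a b, HasDerivAt f (u t) t) → HasDerivBounds M a b n u →
      ∫⁻ t in Ioo a b, rootDeriv (n + 1) f u t ≤ B) :
    ∃ K : ℝ≥0∞, K ≠ ⊤ ∧ ∀ f u : ℝ → ℝ, (∀ t ∈ Ioo a b, HasDerivAt f (u t) t) →
      HasDerivBounds M a b (n + 1) u → ∀ r : ℝ, 0 < r →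
        volume {t ∈ Ioo a b | ENNReal.ofReal r < rootDeriv (n + 2) f u t} ≤
          K * ENNReal.ofReal (r ^ (-((((n + 1 : ℕ) : ℝ) + 1) / (n + 1 : ℕ)))) := by
  refine ⟨4 * (ENNReal.ofReal (4 * (M + 1) ^ (1 / (n + 1 : ℕ) : ℝ)) +
        ENNReal.ofReal ((n + 1 : ℕ) + 5) * B), ?_, fun f u hf hu r hr => ?_⟩
  · exact ENNReal.mul_ne_top (by norm_num) (ENNReal.add_ne_top.2 ⟨ENNReal.ofReal_ne_top,
      ENNReal.mul_ne_top ENNReal.ofReal_ne_top hB⟩)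
  · obtain ⟨hM, g, hg, hgb⟩ := hu
    refine (volume_lt_rootDeriv_le (n := n + 1) (by omega) hr hf hg hgb.continuousOn hM).trans ?_
    gcongr
    exact h u g hg hgb

/-- Order 1 is the bound on the derivative itself. Each step gives a weak bound of exponent
(n+2)/(n+1) > 1, which on a bounded interval implies integrability. -/
theorem exists_lintegral_rootDeriv_le (a b M : ℝ) (n : ℕ) :
    ∃ B : ℝ≥0∞, B ≠ ⊤ ∧ ∀ f u : ℝ → ℝ, (∀ t ∈ Ioo a b, HasDerivAt f (u t) t) →
      HasDerivBounds M a b n u → ∫⁻ t in Ioo a b, rootDeriv (n + 1) f u t ≤ B := by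
  induction n with
  | zero =>
    refine ⟨ENNReal.ofReal M * volume (Ioo a b), ENNReal.mul_ne_top ENNReal.ofReal_ne_top
      (by simp), fun f u _ hu => ?_⟩
    rw [← setLIntegral_const]
    refine setLIntegral_mono' measurableSet_Ioo fun t ht => ?_
    simp only [rootDeriv, zero_add, Nat.cast_one, div_one, sub_self, ENNReal.rpow_zero]
    rw [← ofReal_norm]
    exact ENNReal.ofReal_le_ofReal (hu.norm_le t ht)
  | succ n ih =>
    obtain ⟨B, hB, h⟩ := ih
    obtain ⟨K, hK, hw⟩ := exists_volume_lt_rootDeriv_le_of_lintegral hB h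
    obtain ⟨B', hB', h'⟩ := exists_lintegral_rpow_le_of_weak (q := 1)
      (p := (((n + 1 : ℕ) : ℝ) + 1) / (n + 1 : ℕ)) (V := volume (Ioo a b)) one_pos
      (by rw [one_lt_div (by positivity)]; linarith) hK (by simp)
    refine ⟨B', hB', fun f u hf hu => ?_⟩
    have := h' (volume.restrict (Ioo a b)) (rootDeriv (n + 1 + 1) f u)
      (aemeasurable_rootDeriv (fun t ht => (hf t ht).continuousAt.continuousWithinAt)
        hu.continuousOn) (by simp) fun r hr => ?_
    · simpa using this
    · rw [Measure.restrict_apply' measurableSet_Ioo, inter_comm]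
      exact hw f u hf hu r hr

/-! ### Weak-type bounds and complex radicals. -/

/-- The weak `L^p` bound `|{t ∈ (a, b) : h t > r}| ≤ K r ^ (-p)` for all `r > 0`. -/
def WeakBound (p a b : ℝ) (K : ℝ≥0∞) (h : ℝ → ℝ≥0∞) : Prop :=
  ∀ r : ℝ, 0 < r → volume {t ∈ Ioo a b | ENNReal.ofReal r < h t} ≤ K * ENNReal.ofReal (r ^ (-p))

namespace WeakBound

variable {p p' a b : ℝ} {K L : ℝ≥0∞} {h g : ℝ → ℝ≥0∞}

theorem mono_ae (hh : WeakBound p a b K h)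
    (hg : ∀ᵐ t ∂volume.restrict (Ioo a b), g t ≤ h t) : WeakBound p a b K g := by
  intro r hr
  refine le_trans (measure_mono_ae ?_) (hh r hr)
  rw [ae_restrict_iff' measurableSet_Ioo] at hg
  filter_upwards [hg] with t ht hmem
  exact ⟨hmem.1, hmem.2.trans_le (ht hmem.1)⟩

theorem mono (hh : WeakBound p a b K h) (hg : ∀ t ∈ Ioo a b, g t ≤ h t) : WeakBound p a b K g :=
  hh.mono_ae ((ae_restrict_iff' measurableSet_Ioo).2 (Filter.Eventually.of_forall hg))

theorem add (hh : WeakBound p a b K h) (hg : WeakBound p a b L g) :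
    WeakBound p a b ((K + L) * ENNReal.ofReal (2 ^ p)) (fun t => h t + g t) := by
  intro r hr
  have hr2 : 0 < r / 2 := by positivity
  have hsub : {t ∈ Ioo a b | ENNReal.ofReal r < h t + g t} ⊆
      {t ∈ Ioo a b | ENNReal.ofReal (r / 2) < h t} ∪
        {t ∈ Ioo a b | ENNReal.ofReal (r / 2) < g t} := by
    rintro t ⟨ht, hlt⟩
    by_contra hcon
    simp only [mem_union, mem_ofPred_eq, ht, true_and, not_or, not_lt] at hcon
    refine absurd hlt (not_lt.2 ((add_le_add hcon.1 hcon.2).trans ?_))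
    rw [← ENNReal.ofReal_add hr2.le hr2.le, add_halves]
  have he : ENNReal.ofReal ((r / 2) ^ (-p)) = ENNReal.ofReal (2 ^ p) * ENNReal.ofReal (r ^ (-p)) := by
    rw [← ENNReal.ofReal_mul (by positivity), Real.div_rpow hr.le (by norm_num),
      Real.rpow_neg (by norm_num : (0 : ℝ) ≤ 2), div_inv_eq_mul, mul_comm]
  calc _ ≤ _ := (measure_mono hsub).trans (measure_union_le _ _)
    _ ≤ _ := add_le_add (hh _ hr2) (hg _ hr2)
    _ = _ := by rw [he]; ring

theorem const_mul {c : ℝ} (hc : 0 < c) (hh : WeakBound p a b K h) :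
    WeakBound p a b (K * ENNReal.ofReal (c ^ p)) (fun t => ENNReal.ofReal c * h t) := by
  intro r hr
  have he : ENNReal.ofReal ((r / c) ^ (-p)) = ENNReal.ofReal (c ^ p) * ENNReal.ofReal (r ^ (-p)) := by
    rw [← ENNReal.ofReal_mul (by positivity), Real.div_rpow hr.le hc.le,
      Real.rpow_neg hc.le, div_inv_eq_mul, mul_comm]
  rw [mul_assoc, ← he]
  refine (measure_mono ?_).trans (hh _ (div_pos hr hc))
  rintro t ⟨ht, hlt⟩
  refine ⟨ht, ?_⟩
  by_contra! hcon
  refine absurd hlt (not_lt.2 ?_)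
  calc ENNReal.ofReal c * h t ≤ ENNReal.ofReal c * ENNReal.ofReal (r / c) := mul_le_mul_right hcon _
    _ = _ := by rw [← ENNReal.ofReal_mul hc.le, mul_div_cancel₀ _ hc.ne']

theorem of_le {M : ℝ} (hM : 0 ≤ M) (hp : 0 < p) (hh : ∀ t ∈ Ioo a b, h t ≤ ENNReal.ofReal M) :
    WeakBound p a b (volume (Ioo a b) * ENNReal.ofReal (M ^ p)) h := by
  intro r hr
  rcases lt_or_ge r M with hlt | hle
  · have : (1 : ℝ≥0∞) ≤ ENNReal.ofReal (M ^ p) * ENNReal.ofReal (r ^ (-p)) := by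
      rw [← ENNReal.ofReal_mul (by positivity), ENNReal.one_le_ofReal, Real.rpow_neg hr.le,
        ← div_eq_mul_inv, one_le_div (by positivity)]
      gcongr
    calc _ ≤ volume (Ioo a b) := measure_mono fun t ht => ht.1
      _ ≤ volume (Ioo a b) * (ENNReal.ofReal (M ^ p) * ENNReal.ofReal (r ^ (-p))) :=
          le_mul_of_one_le_right' this
      _ = _ := by ring
  · have : {t ∈ Ioo a b | ENNReal.ofReal r < h t} = ∅ := by
      refine eq_empty_of_forall_notMem fun t ht => ?_
      exact absurd ht.2 (not_lt.2 ((hh t ht.1).trans (ENNReal.ofReal_le_ofReal hle)))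
    rw [this, measure_empty]
    exact zero_le

theorem of_exponent_le (hh : WeakBound p' a b K h) (hp : 0 < p) (hpp' : p ≤ p') :
    WeakBound p a b (K + volume (Ioo a b)) h := by
  intro r hr
  rcases le_total 1 r with h1 | h1
  · calc _ ≤ K * ENNReal.ofReal (r ^ (-p')) := hh r hr
      _ ≤ (K + volume (Ioo a b)) * ENNReal.ofReal (r ^ (-p)) := by
          gcongr
          exact le_self_add
  · calc _ ≤ volume (Ioo a b) := measure_mono fun t ht => ht.1
      _ ≤ volume (Ioo a b) * ENNReal.ofReal (r ^ (-p)) := by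
          refine le_mul_of_one_le_right' ?_
          rw [ENNReal.one_le_ofReal]
          exact Real.one_le_rpow_of_pos_of_le_one_of_nonpos hr h1 (by linarith)
      _ ≤ _ := by gcongr; exact le_add_self

theorem quasinorm_le (hp : 0 < p) {f : ℝ → ℂ} (hf : WeakBound p a b K (fun t => ‖f t‖ₑ)) :
    weakLpQuasinorm p f (Ioo a b) ≤ K ^ (1 / p) := by
  refine iSup_le fun r => ?_
  rcases eq_or_ne r 0 with rfl | hr
  · simp
  have hr0 : (0 : ℝ) < r := NNReal.coe_pos.2 (pos_iff_ne_zero.2 hr)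
  have hset : {x ∈ Ioo a b | (r : ℝ) < ‖f x‖} =
      {x ∈ Ioo a b | ENNReal.ofReal (r : ℝ) < ‖f x‖ₑ} := by
    ext t
    simp only [mem_ofPred_eq]
    rw [← ofReal_norm, ENNReal.ofReal_lt_ofReal_iff_of_nonneg hr0.le]
  rw [hset]
  calc _ ≤ (r : ℝ≥0∞) * (K * ENNReal.ofReal ((r : ℝ) ^ (-p))) ^ (1 / p) := by
        gcongr
        exact hf r hr0
    _ = K ^ (1 / p) * ((r : ℝ≥0∞) * ENNReal.ofReal ((r : ℝ)⁻¹)) := by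
        rw [ENNReal.mul_rpow_of_nonneg _ _ (by positivity),
          ENNReal.ofReal_rpow_of_nonneg (by positivity) (by positivity), ← Real.rpow_mul hr0.le,
          show -p * (1 / p) = -1 by field_simp, Real.rpow_neg_one]
        ring
    _ ≤ K ^ (1 / p) := by
        rw [← ENNReal.ofReal_coe_nnreal, ← ENNReal.ofReal_mul hr0.le, mul_inv_cancel₀ hr0.ne']
        simp

end WeakBound

/-- Replacing |f| by the modulus of its real or imaginary part only shrinks the denominators, so the
real estimate suffices. -/
theorem rootDeriv_le_re_add_im {k : ℕ} (hk : 1 ≤ k) (f g : ℝ → ℂ) (t : ℝ) :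
    rootDeriv k f g t ≤ rootDeriv k (fun s => (f s).re) (fun s => (g s).re) t +
      rootDeriv k (fun s => (f s).im) (fun s => (g s).im) t := by
  have he : (0 : ℝ) ≤ 1 - 1 / k := by
    rw [sub_nonneg, div_le_one (by exact_mod_cast hk)]; exact_mod_cast hk
  unfold rootDeriv
  have hg : ‖g t‖ₑ ≤ ‖(g t).re‖ₑ + ‖(g t).im‖ₑ := by
    rw [← ofReal_norm, ← ofReal_norm, ← ofReal_norm, ← ENNReal.ofReal_add (norm_nonneg _)
      (norm_nonneg _)]
    exact ENNReal.ofReal_le_ofReal (Complex.norm_le_abs_re_add_abs_im _)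
  have hre : ‖(f t).re‖ₑ ≤ ‖f t‖ₑ := by
    rw [← ofReal_norm, ← ofReal_norm]
    exact ENNReal.ofReal_le_ofReal (Complex.abs_re_le_norm _)
  have him : ‖(f t).im‖ₑ ≤ ‖f t‖ₑ := by
    rw [← ofReal_norm, ← ofReal_norm]
    exact ENNReal.ofReal_le_ofReal (Complex.abs_im_le_norm _)
  calc _ ≤ (‖(g t).re‖ₑ + ‖(g t).im‖ₑ) / ‖f t‖ₑ ^ (1 - 1 / (k : ℝ)) := by gcongr
    _ = _ := ENNReal.add_div
    _ ≤ _ := by gcongr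

/-- A function with `n + 2` bounded derivatives satisfies a uniform weak-type bound for the
derivative of its radical of order `n + 2`. -/
theorem exists_weakBound_rootDeriv (a b M : ℝ) (n : ℕ) {p : ℝ} (hp : 0 < p)
    (hpn : p * (n + 1) ≤ n + 2) :
    ∃ K : ℝ≥0∞, K ≠ ⊤ ∧ ∀ f u : ℝ → ℂ, (∀ t ∈ Ioo a b, HasDerivAt f (u t) t) →
      HasDerivBounds M a b (n + 1) u → WeakBound p a b K (rootDeriv (n + 2) f u) := by
  obtain ⟨B, hB, h⟩ := exists_lintegral_rootDeriv_le a b M n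
  obtain ⟨K, hK, hw⟩ := exists_volume_lt_rootDeriv_le_of_lintegral hB h
  have hp' : p ≤ (((n + 1 : ℕ) : ℝ) + 1) / (n + 1 : ℕ) := by
    rw [le_div_iff₀ (by positivity)]; push_cast; linarith
  refine ⟨((K + volume (Ioo a b)) + (K + volume (Ioo a b))) * ENNReal.ofReal (2 ^ p),
    ENNReal.mul_ne_top (by simp [hK]) ENNReal.ofReal_ne_top, fun f u hf hu => ?_⟩
  have h1 : WeakBound _ a b K (rootDeriv (n + 2) (fun s => (f s).re) (fun s => (u s).re)) :=
    hw _ _ (fun t ht => Complex.reCLM.hasFDerivAt.comp_hasDerivAt t (hf t ht))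
      (hu.comp_clm Complex.reCLM Complex.abs_re_le_norm)
  have h2 : WeakBound _ a b K (rootDeriv (n + 2) (fun s => (f s).im) (fun s => (u s).im)) :=
    hw _ _ (fun t ht => Complex.imCLM.hasFDerivAt.comp_hasDerivAt t (hf t ht))
      (hu.comp_clm Complex.imCLM Complex.abs_im_le_norm)
  exact ((h1.of_exponent_le hp hp').add (h2.of_exponent_le hp hp')).mono
    fun t _ => rootDeriv_le_re_add_im (by omega) f u t

/-! ### Absolute continuity and weak derivatives. -/

theorem AbsolutelyContinuousOnInterval.clm_comp {E F : Type*} [NormedAddCommGroup E]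
    [NormedSpace ℝ E] [NormedAddCommGroup F] [NormedSpace ℝ F] (L : E →L[ℝ] F)
    (hL : ∀ x, ‖L x‖ ≤ ‖x‖) {f : ℝ → E} {a b : ℝ} (hf : AbsolutelyContinuousOnInterval f a b) :
    AbsolutelyContinuousOnInterval (fun t => L (f t)) a b := by
  refine squeeze_zero (fun _ => Finset.sum_nonneg fun _ _ => dist_nonneg) (fun E => ?_) hf
  gcongr
  rw [dist_eq_norm, dist_eq_norm, ← map_sub]
  exact hL _

theorem AbsolutelyContinuousOnInterval.ae_differentiableAt_complex {f : ℝ → ℂ} {a b : ℝ}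
    (hf : AbsolutelyContinuousOnInterval f a b) :
    ∀ᵐ x, x ∈ uIcc a b → DifferentiableAt ℝ f x := by
  filter_upwards [(hf.clm_comp Complex.reCLM Complex.abs_re_le_norm).ae_differentiableAt,
    (hf.clm_comp Complex.imCLM Complex.abs_im_le_norm).ae_differentiableAt] with x h1 h2 hx
  have := (Complex.ofRealCLM.differentiableAt.comp x (h1 hx)).add
    ((Complex.ofRealCLM.differentiableAt.comp x (h2 hx)).mul_const Complex.I)
  refine this.congr_of_eventuallyEq (Filter.Eventually.of_forall fun t => ?_)
  exact (Complex.re_add_im (f t)).symm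

theorem AbsolutelyContinuousOnInterval.integral_deriv_eq_sub_complex {f : ℝ → ℂ} {a b : ℝ}
    (hf : AbsolutelyContinuousOnInterval f a b) (hi : IntervalIntegrable (deriv f) volume a b) :
    ∫ x in a..b, deriv f x = f b - f a := by
  have hd := hf.ae_differentiableAt_complex
  have key : ∀ L : ℂ →L[ℝ] ℝ, (∀ x, ‖L x‖ ≤ ‖x‖) →
      L (∫ x in a..b, deriv f x) = L (f b - f a) := by
    intro L hL
    rw [← L.intervalIntegral_comp_comm hi, map_sub,
      ← (hf.clm_comp L hL).integral_deriv_eq_sub]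
    refine intervalIntegral.integral_congr_ae ?_
    filter_upwards [hd] with x hx hmem
    exact (L.hasFDerivAt.comp_hasDerivAt x (hx (uIoc_subset_uIcc hmem)).hasDerivAt).deriv.symm
  exact Complex.ext (key Complex.reCLM Complex.abs_re_le_norm)
    (key Complex.imCLM Complex.abs_im_le_norm)

section
variable {lam : ℝ → ℂ} {h : ℝ → ℝ≥0∞} {α β : ℝ}

theorem norm_sub_le_integral_toReal (hm : AEMeasurable h (volume.restrict (Ioo α β)))
    (hfin : ∫⁻ t in Ioo α β, h t ≠ ⊤)
    (hl : ∀ s ∈ Ioo α β, ∀ t ∈ Ioo α β, s ≤ t → ‖lam s - lam t‖ₑ ≤ ∫⁻ r in Ioc s t, h r) :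
    IntegrableOn (fun t => (h t).toReal) (Ioo α β) ∧
    ∀ s ∈ Ioo α β, ∀ t ∈ Ioo α β, s ≤ t → ‖lam s - lam t‖ ≤ ∫ r in s..t, (h r).toReal := by
  refine ⟨integrable_toReal_of_lintegral_ne_top hm hfin, fun s hs t ht hst => ?_⟩
  have hsub : Ioc s t ⊆ Ioo α β := fun r hr => ⟨hs.1.trans hr.1, hr.2.trans_lt ht.2⟩
  have hm' := hm.mono_measure (Measure.restrict_mono_set volume hsub)
  have hfin' : ∫⁻ r in Ioc s t, h r ≠ ⊤ := ((lintegral_mono_set hsub).trans_lt hfin.lt_top).ne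
  rw [intervalIntegral.integral_of_le hst, integral_toReal hm' (ae_lt_top' hm' hfin'),
    ← toReal_enorm]
  exact ENNReal.toReal_mono hfin' (hl s hs t ht hst)

/-- The increments are dominated by those of a primitive of h, so absolute continuity is inherited,
and Lebesgue differentiation of the primitive bounds the derivative. -/
theorem absolutelyContinuousOnInterval_of_le_lintegral
    (hm : AEMeasurable h (volume.restrict (Ioo α β)))
    (hfin : ∫⁻ t in Ioo α β, h t ≠ ⊤)
    (hl : ∀ s ∈ Ioo α β, ∀ t ∈ Ioo α β, s ≤ t → ‖lam s - lam t‖ₑ ≤ ∫⁻ r in Ioc s t, h r)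
    {a b : ℝ} (ha : a ∈ Ioo α β) (hb : b ∈ Ioo α β) (hab : a ≤ b) :
    AbsolutelyContinuousOnInterval lam a b ∧
      ∀ᵐ t, t ∈ Ioo a b → ‖deriv lam t‖ ≤ (h t).toReal := by
  obtain ⟨hint, hle⟩ := norm_sub_le_integral_toReal hm hfin hl
  have hsub : Icc a b ⊆ Ioo α β := fun t ht => ⟨ha.1.trans_le ht.1, ht.2.trans_lt hb.2⟩
  have hi : ∀ s ∈ Icc a b, ∀ t ∈ Icc a b,
      IntervalIntegrable (fun t => (h t).toReal) volume s t := fun s hs t ht =>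
    (hint.mono_set ((uIcc_subset_Icc hs ht).trans hsub)).intervalIntegrable
  have haI : a ∈ Icc a b := left_mem_Icc.2 hab
  have hbI : b ∈ Icc a b := right_mem_Icc.2 hab
  have hG := (hi a haI b hbI).absolutelyContinuousOnInterval_intervalIntegral
    (c := a) (by simp)
  set G : ℝ → ℝ := fun x => ∫ t in a..x, (h t).toReal with hGdef
  have hdist : ∀ s ∈ Icc a b, ∀ t ∈ Icc a b, dist (lam s) (lam t) ≤ dist (G s) (G t) := by
    have hwlog : ∀ s ∈ Icc a b, ∀ t ∈ Icc a b, s ≤ t → dist (lam s) (lam t) ≤ dist (G s) (G t) := by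
      intro s hs t ht hst
      rw [dist_comm (G s), dist_eq_norm, Real.dist_eq]
      refine (hle s (hsub hs) t (hsub ht) hst).trans ?_
      rw [hGdef]
      simp only
      rw [intervalIntegral.integral_interval_sub_left (hi a haI t ht) (hi a haI s hs)]
      exact le_abs_self _
    intro s hs t ht
    rcases le_total s t with hst | hst
    · exact hwlog s hs t ht hst
    · rw [dist_comm, dist_comm (G s)]; exact hwlog t ht s hs hst
  have hAC : AbsolutelyContinuousOnInterval lam a b := by
    refine squeeze_zero' (Filter.Eventually.of_forall fun _ =>
      Finset.sum_nonneg fun _ _ => dist_nonneg) ?_ hG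
    rw [Filter.eventually_inf_principal]
    refine Filter.Eventually.of_forall fun E hE => ?_
    refine Finset.sum_le_sum fun i hi => ?_
    have := hE.1 i hi
    rw [uIcc_of_le hab] at this
    exact hdist _ this.1 _ this.2
  refine ⟨hAC, ?_⟩
  filter_upwards [hAC.ae_differentiableAt_complex, (hi a haI b hbI).ae_hasDerivAt_integral]
    with t h1 h2 ht
  have htI : t ∈ uIcc a b := by rw [uIcc_of_le hab]; exact Ioo_subset_Icc_self ht
  have hd1 := (h1 htI).hasDerivAt
  have hd2 := h2 htI a (by simp)
  have hd1' := (hasDerivAt_iff_tendsto_slope.1 hd1).norm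
  have hd2' := (hasDerivAt_iff_tendsto_slope.1 hd2).norm
  rw [Real.norm_of_nonneg ENNReal.toReal_nonneg] at hd2'
  refine le_of_tendsto_of_tendsto hd1' hd2' ?_
  filter_upwards [nhdsWithin_le_nhds (Icc_mem_nhds ht.1 ht.2)] with s hs
  rw [slope_def_module, slope_def_module, norm_smul, norm_smul]
  gcongr
  rw [← dist_eq_norm, ← dist_eq_norm]
  exact hdist s hs t (Ioo_subset_Icc_self ht)

theorem ae_enorm_deriv_le (hm : AEMeasurable h (volume.restrict (Ioo α β)))
    (hfin : ∫⁻ t in Ioo α β, h t ≠ ⊤)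
    (hl : ∀ s ∈ Ioo α β, ∀ t ∈ Ioo α β, s ≤ t → ‖lam s - lam t‖ₑ ≤ ∫⁻ r in Ioc s t, h r) :
    ∀ᵐ t ∂volume.restrict (Ioo α β), ‖deriv lam t‖ₑ ≤ h t := by
  have hreal : ∀ᵐ t, t ∈ Ioo α β → ‖deriv lam t‖ ≤ (h t).toReal := by
    have hall : ∀ᵐ t, ∀ m : ℕ, t ∈ Ioo (α + 1 / (m + 1 : ℝ)) (β - 1 / (m + 1 : ℝ)) →
        ‖deriv lam t‖ ≤ (h t).toReal := by
      rw [ae_all_iff]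
      intro m
      have hm0 : (0 : ℝ) < 1 / (m + 1 : ℝ) := by positivity
      rcases lt_or_ge (β - 1 / (m + 1 : ℝ)) (α + 1 / (m + 1 : ℝ)) with hlt | hle
      · exact Filter.Eventually.of_forall fun t ht => absurd (ht.1.trans ht.2) hlt.not_gt
      · exact (absolutelyContinuousOnInterval_of_le_lintegral hm hfin hl
          ⟨by linarith, by linarith⟩ ⟨by linarith, by linarith⟩ hle).2
    filter_upwards [hall] with t ht hmem
    obtain ⟨m, hmm⟩ := exists_nat_one_div_lt (lt_min (sub_pos.2 hmem.1) (sub_pos.2 hmem.2))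
    rw [lt_min_iff] at hmm
    exact ht m ⟨by linarith [hmm.1], by linarith [hmm.2]⟩
  filter_upwards [(ae_restrict_iff' measurableSet_Ioo).2 hreal] with t ht
  rw [← ofReal_norm]
  exact (ENNReal.ofReal_le_ofReal ht).trans ENNReal.ofReal_toReal_le

theorem integrableOn_deriv_of_le_lintegral (hm : AEMeasurable h (volume.restrict (Ioo α β)))
    (hfin : ∫⁻ t in Ioo α β, h t ≠ ⊤)
    (hl : ∀ s ∈ Ioo α β, ∀ t ∈ Ioo α β, s ≤ t → ‖lam s - lam t‖ₑ ≤ ∫⁻ r in Ioc s t, h r) :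
    IntegrableOn (deriv lam) (Ioo α β) :=
  ⟨(measurable_deriv lam).aestronglyMeasurable,
    (lintegral_mono_ae (ae_enorm_deriv_le hm hfin hl)).trans_lt hfin.lt_top⟩

/-- A continuous function whose increments are bounded by the integral of an integrable function
is weakly differentiable. -/
theorem hasWeakDerivOn_of_le_lintegral (hlam : ContinuousOn lam (Ioo α β))
    (hm : AEMeasurable h (volume.restrict (Ioo α β)))
    (hfin : ∫⁻ t in Ioo α β, h t ≠ ⊤)
    (hl : ∀ s ∈ Ioo α β, ∀ t ∈ Ioo α β, s ≤ t → ‖lam s - lam t‖ₑ ≤ ∫⁻ r in Ioc s t, h r) :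
    HasWeakDerivOn lam (deriv lam) (Ioo α β) := by
  have hint := integrableOn_deriv_of_le_lintegral hm hfin hl
  refine ⟨hlam.locallyIntegrableOn measurableSet_Ioo, hint.locallyIntegrableOn, ?_⟩
  intro φ hφ hc hsupp
  have hφd : ∀ t, HasDerivAt φ (deriv φ t) t := fun t =>
    (hφ.differentiable (by simp) t).hasDerivAt
  rcases (tsupport φ).eq_empty_or_nonempty with hemp | hne
  · have h0 : φ = 0 := tsupport_eq_empty_iff.1 hemp
    simp [h0]
  have hK : IsCompact (tsupport φ) := hc
  obtain ⟨x, hx, hxmin⟩ := hK.exists_isLeast hne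
  obtain ⟨y, hy, hymax⟩ := hK.exists_isGreatest hne
  -- The compact interval [a, b] strictly encloses the support of φ, so the boundary terms vanish.
  obtain ⟨a, haα, hax⟩ := exists_between (hsupp hx).1
  obtain ⟨b, hyb, hbβ⟩ := exists_between (hsupp hy).2
  have hxy : x ≤ y := hxmin hy
  have hab : a ≤ b := by linarith
  have ha : a ∈ Ioo α β := ⟨haα, by linarith⟩
  have hb : b ∈ Ioo α β := ⟨by linarith, hbβ⟩
  have hsub : Icc a b ⊆ Ioo α β := fun t ht => ⟨ha.1.trans_le ht.1, ht.2.trans_lt hb.2⟩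
  have hout : ∀ t, t ∉ Ioc a b → t ∉ tsupport φ := fun t ht hts =>
    ht ⟨hax.trans_le (hxmin hts), (hymax hts).trans hyb.le⟩
  have hφ0 : ∀ t, t ∉ Ioc a b → φ t = 0 := fun t ht => image_eq_zero_of_notMem_tsupport (hout t ht)
  have hφ0' : ∀ t, t ∉ Ioc a b → deriv φ t = 0 := fun t ht =>
    image_eq_zero_of_notMem_tsupport fun h => hout t ht (tsupport_deriv_subset h)
  have hIoc : Ioc a b ⊆ Ioo α β := Ioc_subset_Icc_self.trans hsub
  have hAC := (absolutelyContinuousOnInterval_of_le_lintegral hm hfin hl ha hb hab).1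
  have hACφ : AbsolutelyContinuousOnInterval φ a b :=
    ((hφ.of_le (by simp)).contDiffOn).absolutelyContinuousOnInterval
  have hACp : AbsolutelyContinuousOnInterval (fun t => lam t * φ t) a b := hAC.fun_smul hACφ
  have hφc : Continuous φ := hφ.continuous
  have hφ'c : Continuous (deriv φ) := hφ.continuous_deriv (by simp)
  have hlab : ContinuousOn lam (uIcc a b) := by rw [uIcc_of_le hab]; exact hlam.mono hsub
  have hdi : IntervalIntegrable (deriv lam) volume a b := by
    rw [intervalIntegrable_iff_integrableOn_Ioc_of_le hab]
    exact hint.mono_set hIoc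
  have i1 : IntervalIntegrable (fun t => deriv lam t * φ t) volume a b :=
    hdi.mul_continuousOn hφc.continuousOn
  have i2 : IntervalIntegrable (fun t => lam t * deriv φ t) volume a b :=
    (hlab.mul hφ'c.continuousOn).intervalIntegrable
  have hae : ∀ᵐ t, t ∈ uIoc a b →
      deriv (fun t => lam t * φ t) t = deriv lam t * φ t + lam t * deriv φ t := by
    filter_upwards [hAC.ae_differentiableAt_complex] with t ht hmem
    exact ((ht (uIoc_subset_uIcc hmem)).hasDerivAt.mul (hφd t)).deriv
  have hsum : ∫ t in a..b, (deriv lam t * φ t + lam t * deriv φ t) = 0 := by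
    rw [← intervalIntegral.integral_congr_ae hae, hACp.integral_deriv_eq_sub_complex]
    · have e1 : φ a = 0 := hφ0 a fun h => lt_irrefl _ h.1
      have e2 : φ b = 0 := image_eq_zero_of_notMem_tsupport fun h =>
        absurd (hymax h) hyb.not_ge
      simp [e1, e2]
    · refine (i1.add i2).congr_ae ?_
      rw [Filter.EventuallyEq, ae_restrict_iff' measurableSet_uIoc]
      filter_upwards [hae] with t ht hmem using (ht hmem).symm
  rw [intervalIntegral.integral_add i1 i2, intervalIntegral.integral_of_le hab,
    intervalIntegral.integral_of_le hab] at hsum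
  rw [setIntegral_eq_of_subset_of_forall_sdiff_eq_zero measurableSet_Ioo hIoc
      fun t ht => by simp [hφ0' t ht.2],
    setIntegral_eq_of_subset_of_forall_sdiff_eq_zero measurableSet_Ioo hIoc
      fun t ht => by simp [hφ0 t ht.2]]
  linear_combination hsum

end

/-! ### Uniform estimates for the roots of cubics. -/

theorem exists_hasDerivBounds_depressed (α β : ℝ) {M : ℝ} (hM : 0 ≤ M) (n : ℕ) :
    ∃ N : ℝ, ∀ a b c : ℝ → ℂ, HasDerivBounds M α β n a → HasDerivBounds M α β n b →
      HasDerivBounds M α β n c → ∀ p q : ℝ → ℂ, (∀ t, p t = b t - 1 / 3 * a t ^ 2) →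
      (∀ t, q t = c t - 1 / 3 * (a t * b t) + 2 / 27 * a t ^ 3) →
      HasDerivBounds N α β n p ∧ HasDerivBounds N α β n q ∧
        HasDerivBounds N α β n (fun t => 4 * p t ^ 3 + 27 * q t ^ 2) := by
  set P : ℝ := M + ‖(-1 / 3 : ℂ)‖ * (2 ^ n * M * M) with hP
  set Q : ℝ := M + ‖(-1 / 3 : ℂ)‖ * (2 ^ n * M * M) +
    ‖(2 / 27 : ℂ)‖ * (2 ^ n * M * (2 ^ n * M * M)) with hQ
  have hP0 : 0 ≤ P := by positivity
  have hQ0 : 0 ≤ Q := by positivity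
  set D : ℝ := ‖(4 : ℂ)‖ * (2 ^ n * P * (2 ^ n * P * P)) + ‖(27 : ℂ)‖ * (2 ^ n * Q * Q) with hD
  refine ⟨max P (max Q D), fun a b c ha hb hc p q hp hq => ?_⟩
  have hpB : HasDerivBounds P α β n p := by
    convert! hb.add ((ha.mul hM hM ha).const_mul (-1 / 3)) using 1
    funext t
    rw [hp]; ring
  have hqB : HasDerivBounds Q α β n q := by
    convert! (hc.add ((ha.mul hM hM hb).const_mul (-1 / 3))).add
      ((ha.mul hM (by positivity) (ha.mul hM hM ha)).const_mul (2 / 27)) using 1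
    funext t
    rw [hq]; ring
  have hDB : HasDerivBounds D α β n (fun t => 4 * p t ^ 3 + 27 * q t ^ 2) := by
    convert! ((hpB.mul hP0 (by positivity) (hpB.mul hP0 hP0 hpB)).const_mul 4).add
      ((hqB.mul hQ0 hQ0 hqB).const_mul 27) using 1
    funext t
    ring
  exact ⟨hpB.mono (le_max_left _ _), hqB.mono ((le_max_left _ _).trans (le_max_right _ _)),
    hDB.mono ((le_max_right _ _).trans (le_max_right _ _))⟩

/-- The increments of the continuous roots of a bounded family of cubics are controlled by
integrals of functions satisfying a uniform weak-type bound. -/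
theorem exists_weakBound_root (α β : ℝ) {M : ℝ} (hM : 0 ≤ M) :
    ∃ K : ℝ≥0∞, K ≠ ⊤ ∧ ∀ a : Fin 3 → ℝ → ℂ, (∀ j, HasDerivBounds M α β 6 (a j)) →
      ∀ lam : ℝ → ℂ, IsContinuousRootOn lam (cubicCurve a) (Ioo α β) →
        ∃ h : ℝ → ℝ≥0∞, AEMeasurable h (volume.restrict (Ioo α β)) ∧
          WeakBound (6 / 5) α β K h ∧ ∀ s ∈ Ioo α β, ∀ t ∈ Ioo α β, s ≤ t →
            ‖lam s - lam t‖ₑ ≤ ∫⁻ r in Ioc s t, h r := by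
  obtain ⟨N, hN⟩ := exists_hasDerivBounds_depressed α β hM 6
  obtain ⟨K2, hK2, h2⟩ := exists_weakBound_rootDeriv α β N 0 (p := 6 / 5) (by norm_num)
    (by norm_num)
  obtain ⟨K3, hK3, h3⟩ := exists_weakBound_rootDeriv α β N 1 (p := 6 / 5) (by norm_num)
    (by norm_num)
  obtain ⟨K6, hK6, h6⟩ := exists_weakBound_rootDeriv α β N 4 (p := 6 / 5) (by norm_num)
    (by norm_num)
  have hof : ∀ r : ℝ, ENNReal.ofReal r ≠ ⊤ := fun _ => ENNReal.ofReal_ne_top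
  have hvol : volume (Ioo α β) ≠ ⊤ := by simp
  refine ⟨((((K2 + K3) * ENNReal.ofReal (2 ^ (6 / 5 : ℝ)) + K6) * ENNReal.ofReal (2 ^ (6 / 5 : ℝ)))
    * ENNReal.ofReal (4 ^ (6 / 5 : ℝ)) + volume (Ioo α β) * ENNReal.ofReal (M ^ (6 / 5 : ℝ)))
    * ENNReal.ofReal (2 ^ (6 / 5 : ℝ)), ?_, fun a ha lam hlam => ?_⟩
  · simp only [ne_eq, ENNReal.mul_eq_top, ENNReal.add_eq_top, hK2, hK3, hK6, hof, hvol, and_false,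
      false_and, or_false, not_false_eq_true]
  set p : ℝ → ℂ := fun t => a 1 t - 1 / 3 * a 0 t ^ 2 with hp
  set q : ℝ → ℂ := fun t => a 2 t - 1 / 3 * (a 0 t * a 1 t) + 2 / 27 * a 0 t ^ 3 with hq
  obtain ⟨hpB, hqB, hDB⟩ := hN _ _ _ (ha 0) (ha 1) (ha 2) p q (fun _ => rfl) (fun _ => rfl)
  obtain ⟨-, p', hp', hp'B⟩ := id hpB
  obtain ⟨-, q', hq', hq'B⟩ := id hqB
  obtain ⟨-, D', hD', hD'B⟩ := id hDB
  obtain ⟨-, a', ha', ha'B⟩ := id (ha 0)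
  -- The derivative bounds are known for `D'`, whereas the root estimate uses the explicit formula;
  -- uniqueness of derivatives identifies them.
  have hDeq : ∀ t ∈ Ioo α β, D' t = 12 * p t ^ 2 * p' t + 54 * q t * q' t := by
    intro t ht
    refine (hD' t ht).unique ?_
    convert! (((hp' t ht).pow 3).const_mul 4).add (((hq' t ht).pow 2).const_mul 27) using 1
    push_cast
    ring
  set D : ℝ → ℂ := fun t => 4 * p t ^ 3 + 27 * q t ^ 2 with hD
  set E : ℝ → ℂ := fun t => 12 * p t ^ 2 * p' t + 54 * q t * q' t with hE
  have hpc := hpB.continuousOn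
  have hqc := hqB.continuousOn
  have hp'c := hp'B.continuousOn
  have hq'c := hq'B.continuousOn
  have hEc : ContinuousOn E (Ioo α β) := by fun_prop
  have w2 : WeakBound (6 / 5) α β K2 (rootDeriv 2 p p') := h2 p p' hp' (hp'B.of_le (by norm_num))
  have w3 : WeakBound (6 / 5) α β K3 (rootDeriv 3 q q') := h3 q q' hq' (hq'B.of_le (by norm_num))
  have w6 : WeakBound (6 / 5) α β K6 (rootDeriv 6 D E) :=
    (h6 D D' hD' hD'B).mono fun t ht => by unfold rootDeriv; rw [hDeq t ht]
  -- This term accounts for undoing the translation by a third of `a 0`.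
  have w1 : WeakBound (6 / 5) α β (volume (Ioo α β) * ENNReal.ofReal (M ^ (6 / 5 : ℝ)))
      (fun t => ‖a' t‖ₑ) := by
    refine WeakBound.of_le hM (by norm_num) fun t ht => ?_
    rw [← ofReal_norm]
    exact ENNReal.ofReal_le_ofReal (ha'B.norm_le t ht)
  have hm : AEMeasurable (fun t => ENNReal.ofReal 4 * (rootDeriv 2 p p' t + rootDeriv 3 q q' t
      + rootDeriv 6 D E t)) (volume.restrict (Ioo α β)) :=
    (((aemeasurable_rootDeriv hpc hp'c).add (aemeasurable_rootDeriv hqc hq'c)).add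
      (aemeasurable_rootDeriv hDB.continuousOn hEc)).const_mul _
  have hma : AEMeasurable (fun t => ‖a' t‖ₑ) (volume.restrict (Ioo α β)) :=
    (ha'B.continuousOn.aestronglyMeasurable measurableSet_Ioo).enorm
  refine ⟨_, hm.add hma, (((w2.add w3).add w6).const_mul (by norm_num)).add w1, ?_⟩
  intro s hs t ht hst
  have hsub : Icc s t ⊆ Ioo α β := fun r hr => ⟨hs.1.trans_le hr.1, hr.2.trans_lt ht.2⟩
  have hx := enorm_root_sub_le (x := fun t => lam t + 1 / 3 * a 0 t) hp' hq' hp'c hq'c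
    (hlam.continuousOn.add (continuousOn_const.mul (ha 0).continuousOn)) (fun t ht => by
      have := hlam.isRoot t ht
      simp only [cubicCurve, Polynomial.IsRoot.def, Polynomial.eval_add, Polynomial.eval_mul,
        Polynomial.eval_pow, Polynomial.eval_X, Polynomial.eval_C] at this
      simp only [hp, hq]
      linear_combination this) hs ht hst
  have ha0 := enorm_sub_le_lintegral_of_hasDerivAt hst (fun r hr => ha' r (hsub hr))
    (ha'B.continuousOn.mono hsub)
  have hfour : ENNReal.ofReal 4 = 4 := by norm_num
  have hme := hm.mono_measure (Measure.restrict_mono_set volume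
    (Ioc_subset_Icc_self.trans hsub))
  calc ‖lam s - lam t‖ₑ = ‖(lam s + 1 / 3 * a 0 s - (lam t + 1 / 3 * a 0 t))
        + (-1 / 3) * (a 0 s - a 0 t)‖ₑ := by congr 1; ring
    _ ≤ ‖lam s + 1 / 3 * a 0 s - (lam t + 1 / 3 * a 0 t)‖ₑ + ‖(-1 / 3) * (a 0 s - a 0 t)‖ₑ :=
        enorm_add_le _ _
    _ ≤ ‖lam s + 1 / 3 * a 0 s - (lam t + 1 / 3 * a 0 t)‖ₑ + ‖a 0 s - a 0 t‖ₑ := by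
        gcongr
        rw [← ofReal_norm, ← ofReal_norm, norm_mul]
        refine ENNReal.ofReal_le_ofReal (mul_le_of_le_one_left (norm_nonneg _) ?_)
        norm_num
    _ ≤ _ := add_le_add hx ha0
    _ = _ := by
        rw [← hfour, ← lintegral_add_left' hme]
        rfl

theorem WeakBound.lintegral_ne_top {p α β : ℝ} {K : ℝ≥0∞} (hK : K ≠ ⊤)
    {h : ℝ → ℝ≥0∞} (hm : AEMeasurable h (volume.restrict (Ioo α β))) (hw : WeakBound p α β K h)
    {q : ℝ} (hq : 0 < q) (hqp : q < p) : ∫⁻ t in Ioo α β, h t ^ q ≠ ⊤ := by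
  obtain ⟨B, hB, hle⟩ := exists_lintegral_rpow_le_of_weak hq hqp hK
    (V := volume (Ioo α β)) (by simp)
  refine ((hle (volume.restrict (Ioo α β)) h hm (by simp) fun r hr => ?_).trans_lt
    hB.lt_top).ne
  rw [Measure.restrict_apply' measurableSet_Ioo, inter_comm]
  exact hw r hr

theorem exists_quasinorm_deriv_root_le (α β : ℝ) {M : ℝ} (hM : 0 ≤ M) :
    ∃ C : ℝ≥0, ∀ a : Fin 3 → ℝ → ℂ, (∀ j, HasDerivBounds M α β 6 (a j)) →
      ∀ lam : ℝ → ℂ, IsContinuousRootOn lam (cubicCurve a) (Ioo α β) →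
        HasWeakDerivOn lam (deriv lam) (Ioo α β) ∧
        weakLpQuasinorm (6 / 5) (deriv lam) (Ioo α β) ≤ C ∧
        ∀ q : ℝ, 1 ≤ q → q < 6 / 5 → MemW1 q lam (Ioo α β) := by
  obtain ⟨K, hK, hmain⟩ := exists_weakBound_root α β hM
  refine ⟨(K ^ (1 / (6 / 5) : ℝ)).toNNReal, fun a ha lam hlam => ?_⟩
  obtain ⟨h, hm, hw, hl⟩ := hmain a ha lam hlam
  have hfin : ∫⁻ t in Ioo α β, h t ≠ ⊤ := by
    simpa using hw.lintegral_ne_top hK hm (q := 1) one_pos (by norm_num)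
  have hae := ae_enorm_deriv_le hm hfin hl
  have hweak := hasWeakDerivOn_of_le_lintegral hlam.continuousOn hm hfin hl
  have hwd : WeakBound (6 / 5) α β K (fun t => ‖deriv lam t‖ₑ) := hw.mono_ae hae
  refine ⟨hweak, ?_, fun q hq1 hq => ⟨?_, deriv lam, hweak, ?_⟩⟩
  · rw [ENNReal.coe_toNNReal (ENNReal.rpow_ne_top_of_nonneg (by norm_num) hK)]
    exact hwd.quasinorm_le (by norm_num)
  · rcases (Ioo α β).eq_empty_or_nonempty with he | ⟨c, hc⟩
    · simp [he]
    have hb : ∀ t ∈ Ioo α β, ‖lam t‖ ≤ ‖lam c‖ + (∫⁻ r in Ioo α β, h r).toReal := by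
      intro t ht
      have hmono : ∀ {u v : ℝ}, u ∈ Ioo α β → v ∈ Ioo α β → u ≤ v →
          ‖lam u - lam v‖ ≤ (∫⁻ r in Ioo α β, h r).toReal := by
        intro u v hu hv huv
        rw [← toReal_enorm]
        refine ENNReal.toReal_mono hfin ((hl u hu v hv huv).trans (lintegral_mono_set ?_))
        exact fun r hr => ⟨hu.1.trans hr.1, hr.2.trans_lt hv.2⟩
      have h1 : ‖lam t - lam c‖ ≤ (∫⁻ r in Ioo α β, h r).toReal := by
        rcases le_total t c with htc | htc
        · exact hmono ht hc htc
        · rw [norm_sub_rev]; exact hmono hc ht htc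
      have := norm_sub_norm_le (lam t) (lam c)
      linarith
    exact MemLp.of_bound (hlam.continuousOn.aestronglyMeasurable measurableSet_Ioo) _
      ((ae_restrict_iff' measurableSet_Ioo).2 (Filter.Eventually.of_forall hb))
  · refine ⟨(measurable_deriv lam).aestronglyMeasurable, ?_⟩
    have hq0 : 0 < q := by linarith
    rw [eLpNorm_lt_top_iff_lintegral_rpow_enorm_lt_top (by simpa using hq0) (by simp),
      ENNReal.toReal_ofReal hq0.le]
    exact (hwd.lintegral_ne_top hK (measurable_deriv lam).enorm.aemeasurable
      hq0 hq).lt_top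

theorem MemCkClosure.hasDerivBounds {f : ℝ → ℂ} {α β : ℝ} {k : ℕ} {M : ℝ≥0}
    (hf : MemCkClosure k f (Ioo α β)) (hM : ckClosureNorm k f (Ioo α β) ≤ M) :
    HasDerivBounds (M : ℝ) α β k f := by
  refine HasDerivBounds.of_contDiffOn hf.contDiffOn fun j hj t ht => ?_
  have h1 : ‖iteratedDerivWithin j f (Ioo α β) t‖ₑ ≤ M := by
    refine le_trans ?_ hM
    unfold ckClosureNorm
    exact le_iSup₂_of_le j hj (le_iSup₂_of_le t ht le_rfl)
  have := ENNReal.toReal_mono ENNReal.coe_ne_top h1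
  simpa using this

/-- The continuous extensions are bounded on the compact closure, so a single curve is a bounded
family. -/
theorem MemCkClosure.ckClosureNorm_lt_top {f : ℝ → ℂ} {α β : ℝ} {k : ℕ}
    (hf : MemCkClosure k f (Ioo α β)) : ckClosureNorm k f (Ioo α β) < ⊤ := by
  have hex : ∀ j, ∃ C : ℝ≥0, j ≤ k → ∀ t ∈ Ioo α β, ‖iteratedDerivWithin j f (Ioo α β) t‖ₑ ≤ C := by
    intro j
    by_cases hj : j ≤ k
    · obtain ⟨g, hg, heq⟩ := hf.exists_extension j hj
      have hcpt : IsCompact (closure (Ioo α β)) :=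
        isCompact_Icc.of_isClosed_subset isClosed_closure
          (closure_minimal Ioo_subset_Icc_self isClosed_Icc)
      obtain ⟨C, hC⟩ := hcpt.exists_bound_of_continuousOn hg
      refine ⟨C.toNNReal, fun _ t ht => ?_⟩
      rw [← heq ht, ← ofReal_norm]
      exact ENNReal.ofReal_le_ofReal (hC t (subset_closure ht))
    · exact ⟨0, fun h => absurd h hj⟩
  choose C hC using hex
  refine lt_of_le_of_lt (b := ((∑ j ∈ Finset.range (k + 1), C j : ℝ≥0) : ℝ≥0∞)) ?_
    ENNReal.coe_lt_top
  refine iSup₂_le fun j hj => iSup₂_le fun t ht => (hC j hj t ht).trans ?_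
  exact_mod_cast Finset.single_le_sum (f := C) (fun _ _ => zero_le)
    (Finset.mem_range.2 (Nat.lt_succ_of_le hj))

theorem mainTheorem4 (α β : ℝ) (hαβ : α < β) :
    (∀ a : Fin 3 → ℝ → ℂ, (∀ j, MemCkClosure 6 (a j) (Ioo α β)) →
      ∀ lam : ℝ → ℂ, IsContinuousRootOn lam (cubicCurve a) (Ioo α β) →
        (∃ lam' : ℝ → ℂ, HasWeakDerivOn lam lam' (Ioo α β) ∧
          MemWeakLp (6 / 5) lam' (Ioo α β)) ∧
        ∀ q : ℝ, 1 ≤ q → q < 6 / 5 → MemW1 q lam (Ioo α β)) ∧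
    (∀ (N : Type*) (a : N → Fin 3 → ℝ → ℂ),
      (∀ ν j, MemCkClosure 6 (a ν j) (Ioo α β)) →
      (∃ M : ℝ≥0, ∀ ν j, ckClosureNorm 6 (a ν j) (Ioo α β) ≤ M) →
      ∃ C : ℝ≥0, ∀ (ν : N) (lam : ℝ → ℂ),
        IsContinuousRootOn lam (cubicCurve (a ν)) (Ioo α β) →
          ∃ lam' : ℝ → ℂ, HasWeakDerivOn lam lam' (Ioo α β) ∧
            MemWeakLp (6 / 5) lam' (Ioo α β) ∧
            weakLpQuasinorm (6 / 5) lam' (Ioo α β) ≤ C) := by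
  constructor
  · intro a ha lam hlam
    set M : ℝ≥0 := ∑ j, (ckClosureNorm 6 (a j) (Ioo α β)).toNNReal with hM
    have hle : ∀ j, ckClosureNorm 6 (a j) (Ioo α β) ≤ M := by
      intro j
      rw [← ENNReal.coe_toNNReal (ha j).ckClosureNorm_lt_top.ne]
      exact_mod_cast Finset.single_le_sum
        (f := fun j => (ckClosureNorm 6 (a j) (Ioo α β)).toNNReal) (fun _ _ => zero_le)
        (Finset.mem_univ j)
    obtain ⟨C, hC⟩ := exists_quasinorm_deriv_root_le α β M.coe_nonneg
    obtain ⟨h1, h2, h3⟩ := hC a (fun j => (ha j).hasDerivBounds (hle j)) lam hlam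
    exact ⟨⟨_, h1, (measurable_deriv lam).aestronglyMeasurable, h2.trans_lt ENNReal.coe_lt_top⟩, h3⟩
  · rintro N a ha ⟨M, hM⟩
    obtain ⟨C, hC⟩ := exists_quasinorm_deriv_root_le α β M.coe_nonneg
    refine ⟨C, fun ν lam hlam => ?_⟩
    obtain ⟨h1, h2, -⟩ := hC (a ν) (fun j => (ha ν j).hasDerivBounds (hM ν j)) lam hlam
    exact ⟨_, h1, ⟨(measurable_deriv lam).aestronglyMeasurable, h2.trans_lt ENNReal.coe_lt_top⟩, h2⟩
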